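/- \textbf{Definitions.} Let $k\ge 5$ be an integer, $\alpha=180^\circ/k$ (so $0<\alpha<45^\circ$), and let $S$ be a finite set of points in the plane. Let $\Delta_1$ be a triangle $ABC$ (clockwise) with angles $2\alpha,\,90^\circ-\alpha,\,90^\circ-\alpha$ at $A,B,C$ whose angle bisector at $A$ points vertically upward, and let $\Delta_i$ be $\Delta_1$ rotated clockwise around $A$ by $2(i-1)\alpha$, $1\le i\le k$. For a fixed $i$ and a point $q$, the $a$-wedge $W_{q,a}$ is the closed wedge with apex $q$ obtained by translating the wedge of $\Delta_i$ at $A$; the \emph{$a$-nearest neighbor} of $q\in S$ is the first point of $S\setminus\{q\}$ that is hit when $W_{q,a}$ is swept by a line parallel to $BC$ starting at $q$, ties being broken by choosing the most clockwise point as seen from $q$. Wedges $W_{q,b},W_{q,c}$ and $b$-, $c$-nearest neighbors are defined in the same way at $B$ and $C$. $G_i$ is the graph that joins every point of $S$ to its $a$-, $b$- and $c$-nearest neighbors with respect to $\Delta_i$, and $H_k=G_1\cup\dots\cup G_k$ is the \emph{$k$-layer 3-sweep graph} of $S$. \textbf{Algorithm $\mathcal A$.} For a source $q$ and a target $t$,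 choose an index $i$ (depending only on $q$ and $t$) with $t\in W_{q,a}$ with respect to $\Delta_i$. This index travels with the message unchanged, and all wedges, neighbors and edges below refer to $\Delta_i$ and $G_i$. Start at $u=q$ and stop as soon as $u=t$. While $t$ is an interior point of $W_{u,a}$, move from $u$ to its $a$-nearest neighbor. Otherwise, if $u\in W_{t,b}$ (left routing): if $u$ has neighbors $v$ in $G_i$ with $v\in W_{t,b}$ and $u\in W_{v,b}$, move to the first of them in clockwise order around $u$; if there is none, move to the $a$-nearest neighbor of $u$. Otherwise (right routing) do the same with $c$ in place of $b$ and counterclockwise in place of clockwise. A routing algorithm is \emph{$r$-local} if each next vertex is determined by the current vertex $u$, the target $t$, the index $i$ carried by the message, and the $r$-neighborhood of $u$ in $H_k$ (for $r=1$: the neighbors of $u$; for $r=2$: also their neighbors), but not by any other information on $S$ or on the vertices visited before. A path is \emph{angle-monotone of width $\gamma$} if the vectors of all its edges lie in one wedge of angle $\gamma$. The \emph{routing ratio} is the maximum, over all $S$ and all $q,t\in S$, $q\neq t$, of the length of the path found from $q$ to $t$ divided by $|qt|$. \textbf{Theorem.} (1) For every integer $k\ge5$, Algorithm $\mathcal A$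 can be carried out by a 2-local routing algorithm on the $k$-layer 3-sweep graphs $H_k$ of all finite point sets $S$. For all $q,t\in S$ (and every admissible choice of $i$) it reaches $t$ after finitely many steps along edges of $H_k$, on an angle-monotone path of width $90^\circ+\alpha$; its routing ratio is at most $1/\cos(45^\circ+\frac{\alpha}{2})$. (2) For $k=6$, i.e. $\alpha=30^\circ$, $H_6$ is the full-$\Theta_6$-graph of $S$ (each point $q$ is joined, in each of the six closed $60^\circ$ cones at $q$ whose bisectors make angles $90^\circ+60^\circ j$ with the positive horizontal axis, to the point whose projection onto the bisector is nearest to $q$, ties being broken by choosing the most clockwise point). The width in (1) is then $120^\circ$ and the routing ratio is at most $2$. Moreover, on the graphs $H_6$ of all finite point sets $S$ in which no ties occur (i.e. for each point of $S$ and each of its wedges, the sweep line first hits at most one point), Algorithm $\mathcal A$ can be carried out by a 1-local routing algorithm, with the same width $120^\circ$ and routing ratio at most $2$. -/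

import Mathlib

namespace SweepRouting

noncomputable section

/-- The Euclidean plane. -/
abbrev Plane := EuclideanSpace ℝ (Fin 2)

/-- The unit vector whose counterclockwise angle from the positive horizontal axis is `φ`. -/
def unit (φ : ℝ) : Plane := !₂[Real.cos φ, Real.sin φ]

/-- The planar cross product; it is positive iff `v` is counterclockwise of `u`
(by an angle strictly between `0` and `π`) and negative iff `v` is clockwise of `u`. -/
def cross (u v : Plane) : ℝ := u 0 * v 1 - u 1 * v 0

/-! ### 3-sweep graphs

In everything below `X, Y, Z` is the list of corners of a triangle in clockwise order, starting
from the corner under consideration: `(A, B, C)`, `(B, C, A)` or `(C, A, B)`. -/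

/-- The (closed) wedge with apex `q` whose sides are parallel to `XY` and `XZ`, i.e. the wedge
of the triangle at `X` translated so that `X` coincides with `q`. -/
def wedge (X Y Z q : Plane) : Set Plane :=
  {p | ∃ s r : ℝ, 0 ≤ s ∧ 0 ≤ r ∧ p = q + s • (Y - X) + r • (Z - X)}

/-- The time at which `p` is hit by a line parallel to `YZ` that starts at `q` and sweeps the
wedge of `q` at the corner `X`. As `X, Y, Z` is clockwise, it is non-negative on this wedge. -/
def sweepTime (Y Z q p : Plane) : ℝ := cross (Z - Y) (p - q)

/-- `p` is among the first points of `S` (other than `q`) that are hit when the wedge of `q` at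
the corner `X` is swept by a line parallel to `YZ`. -/
def IsFirstHit (X Y Z : Plane) (S : Finset Plane) (q p : Plane) : Prop :=
  p ∈ S ∧ p ≠ q ∧ p ∈ wedge X Y Z q ∧
    ∀ p' ∈ S, p' ≠ q → p' ∈ wedge X Y Z q → sweepTime Y Z q p ≤ sweepTime Y Z q p'

/-- `p` is the nearest neighbour of `q` in its wedge at the corner `X`: it is a first point hit
by the sweep and, in the case of ties, the most clockwise one as seen from `q`. -/
def IsNearest (X Y Z : Plane) (S : Finset Plane) (q p : Plane) : Prop :=
  IsFirstHit X Y Z S q p ∧ ∀ p', IsFirstHit X Y Z S q p' → cross (p' - q) (p - q) ≤ 0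

/-- `p` is the `a`-, `b`- or `c`-nearest neighbour of the point `q` of `S`. -/
def SweepsTo (A B C : Plane) (S : Finset Plane) (q p : Plane) : Prop :=
  q ∈ S ∧ (IsNearest A B C S q p ∨ IsNearest B C A S q p ∨ IsNearest C A B S q p)

/-- The 3-sweep graph of `S` for the triangle `ABC` (points outside `S` are isolated). -/
def threeSweep (A B C : Plane) (S : Finset Plane) : SimpleGraph Plane where
  Adj p q := p ≠ q ∧ (SweepsTo A B C S p q ∨ SweepsTo A B C S q p)
  symm := ⟨fun _ _ h => ⟨h.1.symm, h.2.symm⟩⟩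
  loopless := ⟨fun _ h => h.1 rfl⟩

/-! ### Layered 3-sweep graphs

With `α = π / k`, the `i`-th triangle (`i = 0, …, k - 1`) is isosceles with angle `2α` at the
corner `A`, placed at the origin, and angles `π/2 - α` at `B` and `C`. For `i = 0` the bisector
at `A` points vertically upward; the `i`-th triangle is rotated clockwise by `2πi/k`. -/

/-- The corner `A` of every layer. -/
def cornerA : Plane := 0

/-- The corner `B` of the `i`-th layer. -/
def cornerB (k : ℕ) (i : Fin k) : Plane :=
  unit (Real.pi / 2 + Real.pi / k - 2 * Real.pi * (i : ℕ) / k)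

/-- The corner `C` of the `i`-th layer. -/
def cornerC (k : ℕ) (i : Fin k) : Plane :=
  unit (Real.pi / 2 - Real.pi / k - 2 * Real.pi * (i : ℕ) / k)

/-- The `a`-wedge of `q` in the `i`-th layer. -/
def wedgeA (k : ℕ) (i : Fin k) (q : Plane) : Set Plane :=
  wedge cornerA (cornerB k i) (cornerC k i) q

/-- The `b`-wedge of `q` in the `i`-th layer. -/
def wedgeB (k : ℕ) (i : Fin k) (q : Plane) : Set Plane :=
  wedge (cornerB k i) (cornerC k i) cornerA q

/-- The `c`-wedge of `q` in the `i`-th layer. -/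
def wedgeC (k : ℕ) (i : Fin k) (q : Plane) : Set Plane :=
  wedge (cornerC k i) cornerA (cornerB k i) q

/-- The `i`-th layer, a 3-sweep graph with angles `2α, π/2 - α, π/2 - α`. -/
def layer (k : ℕ) (i : Fin k) (S : Finset Plane) : SimpleGraph Plane :=
  threeSweep cornerA (cornerB k i) (cornerC k i) S

/-- The `k`-layer 3-sweep graph `H_k` of `S`, the union of its `k` layers. -/
def layeredSweep (k : ℕ) (S : Finset Plane) : SimpleGraph Plane := ⨆ i : Fin k, layer k i S

/-- No nearest neighbour of a point of `S` has to be selected by breaking a tie: in each wedge of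
each layer the sweep line hits at most one point of `S` first. -/
def NoTies (k : ℕ) (S : Finset Plane) : Prop :=
  ∀ i : Fin k, ∀ q ∈ S, ∀ p p' : Plane,
    (IsFirstHit cornerA (cornerB k i) (cornerC k i) S q p →
      IsFirstHit cornerA (cornerB k i) (cornerC k i) S q p' → p = p') ∧
    (IsFirstHit (cornerB k i) (cornerC k i) cornerA S q p →
      IsFirstHit (cornerB k i) (cornerC k i) cornerA S q p' → p = p') ∧
    (IsFirstHit (cornerC k i) cornerA (cornerB k i) S q p →
      IsFirstHit (cornerC k i) cornerA (cornerB k i) S q p' → p = p')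

/-! ### Full theta-graphs -/

/-- The set of vectors at angle at most `γ / 2` from the direction `φ` (with the zero vector):
the closed wedge of angle `γ` with apex the origin and bisector in direction `φ`. -/
def cone (φ γ : ℝ) : Set Plane :=
  {v | ‖v‖ * Real.cos (γ / 2) ≤ inner ℝ (unit φ) v}

/-- The direction of the bisector of the `j`-th of `m` cones of angle `2π/m`. -/
def thetaAxis (m : ℕ) (j : Fin m) : ℝ := Real.pi / 2 + 2 * Real.pi * (j : ℕ) / m

/-- `p` is a point of `S` in the `j`-th cone of `q` whose projection to the bisector is nearest
to `q`. -/
def IsThetaClosest (m : ℕ) (j : Fin m) (S : Finset Plane) (q p : Plane) : Prop :=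
  p ∈ S ∧ p ≠ q ∧ p - q ∈ cone (thetaAxis m j) (2 * Real.pi / m) ∧
    ∀ p' ∈ S, p' ≠ q → p' - q ∈ cone (thetaAxis m j) (2 * Real.pi / m) →
      inner ℝ (unit (thetaAxis m j)) (p - q) ≤ inner ℝ (unit (thetaAxis m j)) (p' - q)

/-- `p` is the neighbour that `q` selects in its `j`-th cone; ties are broken by taking the most
clockwise point. -/
def IsThetaNearest (m : ℕ) (j : Fin m) (S : Finset Plane) (q p : Plane) : Prop :=
  IsThetaClosest m j S q p ∧ ∀ p', IsThetaClosest m j S q p' → cross (p' - q) (p - q) ≤ 0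

/-- The full `Θ_m`-graph of `S`. -/
def fullTheta (m : ℕ) (S : Finset Plane) : SimpleGraph Plane where
  Adj p q := p ≠ q ∧ ∃ j : Fin m,
    (p ∈ S ∧ IsThetaNearest m j S p q) ∨ (q ∈ S ∧ IsThetaNearest m j S q p)
  symm := ⟨fun _ _ ⟨hne, j, h⟩ => ⟨hne.symm, j, h.symm⟩⟩
  loopless := ⟨fun _ h => h.1 rfl⟩

/-! ### Algorithm A, in the `i`-th layer and with target `t` -/

/-- `v` is a candidate for Case 1 of left routing at `u`: a neighbour of `u` in the layer such
that `v` is in the `b`-wedge of `t` and `u` is in the `b`-wedge of `v`. -/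
def LeftCandidate (k : ℕ) (i : Fin k) (S : Finset Plane) (t u v : Plane) : Prop :=
  (layer k i S).Adj u v ∧ v ∈ wedgeB k i t ∧ u ∈ wedgeB k i v

/-- One step `u → w` of left routing. Case 1: `w` is the first candidate in clockwise order
around `u`. Case 2: there is no candidate, and `w` is the `a`-neighbour of `u`.
All candidates lie in a wedge of `u` of angle less than `π/2`, where clockwise order around `u`
is given by the sign of the cross product. -/
def LeftStep (k : ℕ) (i : Fin k) (S : Finset Plane) (t u w : Plane) : Prop :=
  (LeftCandidate k i S t u w ∧
    ∀ v, LeftCandidate k i S t u v → v ≠ w → cross (w - u) (v - u) < 0) ∨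
  ((¬ ∃ v, LeftCandidate k i S t u v) ∧
    IsNearest cornerA (cornerB k i) (cornerC k i) S u w)

/-- The mirror image of `LeftCandidate`, with `c`-wedges. -/
def RightCandidate (k : ℕ) (i : Fin k) (S : Finset Plane) (t u v : Plane) : Prop :=
  (layer k i S).Adj u v ∧ v ∈ wedgeC k i t ∧ u ∈ wedgeC k i v

/-- The mirror image of `LeftStep`: in Case 1, `w` is the first candidate in counterclockwise
order around `u`. -/
def RightStep (k : ℕ) (i : Fin k) (S : Finset Plane) (t u w : Plane) : Prop :=
  (RightCandidate k i S t u w ∧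
    ∀ v, RightCandidate k i S t u v → v ≠ w → 0 < cross (w - u) (v - u)) ∨
  ((¬ ∃ v, RightCandidate k i S t u v) ∧
    IsNearest cornerA (cornerB k i) (cornerC k i) S u w)

/-- Algorithm A forwards the message from `u` to `w`. While `t` is an internal point of the
`a`-wedge of `u`, it moves to the `a`-neighbour of `u`. Otherwise it routes left if `u` is in the
`b`-wedge of `t`, and right if not. -/
def StepA (k : ℕ) (i : Fin k) (S : Finset Plane) (t u w : Plane) : Prop :=
  (t ∈ interior (wedgeA k i u) ∧ IsNearest cornerA (cornerB k i) (cornerC k i) S u w) ∨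
  (t ∉ interior (wedgeA k i u) ∧ u ∈ wedgeB k i t ∧ LeftStep k i S t u w) ∨
  (t ∉ interior (wedgeA k i u) ∧ u ∉ wedgeB k i t ∧ RightStep k i S t u w)

/-! ### Local routing -/

/-- The `r`-neighbourhood of `u` in `G`: the edges of `G` with an endpoint at distance less than
`r` from `u`. For `r = 1` these are the edges from `u` to its neighbours, for `r = 2` also the
edges from the neighbours of `u` to their neighbours. -/
def localView (G : SimpleGraph Plane) (r : ℕ) (u : Plane) : SimpleGraph Plane where
  Adj v w := G.Adj v w ∧ ((∃ p : G.Walk u v, p.length < r) ∨ ∃ p : G.Walk u w, p.length < r)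
  symm := ⟨fun _ _ h => ⟨h.1.symm, h.2.symm⟩⟩
  loopless := ⟨fun _ h => h.1.ne rfl⟩

/-- A routing algorithm for `k`-layer graphs. `start q t` is the index of the layer used for
a message from `q` to `t`; it accompanies the message and is never changed. `next i t u V` is
the vertex to which a message for `t` with layer index `i` is forwarded from the current vertex
`u`, if the visible part of the graph is `V`. -/
structure Router (k : ℕ) where
  start : Plane → Plane → Fin k
  next : Fin k → Plane → Plane → SimpleGraph Plane → Plane

/-- The vertices visited by a message from `q` to `t` with layer index `i` in the graph `G`, if
at each vertex only its `r`-neighbourhood is visible. -/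
def Router.route {k : ℕ} (R : Router k) (r : ℕ) (G : SimpleGraph Plane) (i : Fin k)
    (q t : Plane) : ℕ → Plane
  | 0 => q
  | n + 1 => R.next i t (R.route r G i q t n) (localView G r (R.route r G i q t n))

/-- The path `x 0, …, x m` is angle-monotone of width `γ`: the vectors of all its edges lie in
one wedge of angle `γ`. -/
def AngleMonotone (γ : ℝ) (x : ℕ → Plane) (m : ℕ) : Prop :=
  ∃ φ : ℝ, ∀ j < m, x (j + 1) - x j ∈ cone φ γ

/-- The length of the path `x 0, …, x m`. -/
def pathLength (x : ℕ → Plane) (m : ℕ) : ℝ := ∑ j ∈ Finset.range m, dist (x j) (x (j + 1))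

/-- On every finite point set `S` with property `P`, the router `R`, seeing only
`r`-neighbourhoods in `H_k`, executes algorithm A and reaches the target along an angle-monotone
path of width `γ`, with routing ratio at most `ρ`. The layer index is one for which the target
is in the `a`-wedge of the source; if there are several, each of them works. -/
def Router.Works {k : ℕ} (R : Router k) (r : ℕ) (P : Finset Plane → Prop) (γ ρ : ℝ) : Prop :=
  (∀ q t, t ∈ wedgeA k (R.start q t) q) ∧
  ∀ S : Finset Plane, P S → ∀ q ∈ S, ∀ t ∈ S, ∀ i : Fin k, t ∈ wedgeA k i q →
    ∃ m : ℕ,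
      R.route r (layeredSweep k S) i q t m = t ∧
      (∀ j < m,
        R.route r (layeredSweep k S) i q t j ≠ t ∧
        (layeredSweep k S).Adj (R.route r (layeredSweep k S) i q t j)
          (R.route r (layeredSweep k S) i q t (j + 1)) ∧
        StepA k i S t (R.route r (layeredSweep k S) i q t j)
          (R.route r (layeredSweep k S) i q t (j + 1))) ∧
      AngleMonotone γ (R.route r (layeredSweep k S) i q t) m ∧
      pathLength (R.route r (layeredSweep k S) i q t) m ≤ ρ * dist q t

end

end SweepRouting

open SweepRouting

/-!
In the coordinates `a + b + c = 0` given by the sides of a triangle, wedges, sweeps and Algorithm A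
become inequalities between coordinates, and right routing is left routing in the mirror image.
The invariant of left routing at `u` is that every point `p` of `S` with `c t ≤ c p` and
`b u < b p` satisfies `a p ≤ a u`. It holds as soon as the target is no longer interior to the
`a`-wedge, because the previous sweep stopped at the first point that it hit, and it is preserved:
if there is no candidate, then the sweep from `u` reaches the next vertex before it can leave the
`b`-wedge of the target. Along the whole path `a` decreases and `b` (or, for right routing, `c`)
increases. This confines the edges to a cone, and projecting to its bisector bounds the length.

Among the neighbours of `u` in `H_k`, the nearest ones for the `i`-th triangle can be recognized,
so the edges of `G_i` at `u` are determined by the neighbours of `u` and by their neighbours. For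
`k = 6` all edges of `H_6` outside `G_i` come from sweeps with the reflected triangle, and if there
are no ties the invariant tells these from candidates by looking at the neighbours of `u` alone.
-/

namespace SweepRouting

/-- Barycentric coordinates with respect to a triangle `ABC`, normalized to have sum `0`: `a` is
an affine function that is constant along the side opposite to `A` and grows towards `A`, and so on.
The sweeps from the corner `A` are encoded by listing `a` first, those from `B` and `C` are obtained
by `rotate`. The sign of `sgn` says which point wins a tie, so that mirror images need no separate
treatment: positive means that small values of `b` win. -/
structure TriCoords (V : Type*) where
  a : V → ℝ
  b : V → ℝ
  c : V → ℝ
  sgn : ℝ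
  sum_eq_zero (p : V) : a p + b p + c p = 0
  eq_of_coords (p q : V) : b p = b q → c p = c q → p = q
  sgn_ne_zero : sgn ≠ 0

namespace TriCoords

variable {V : Type*} (T : TriCoords V) (S : Finset V)

/-- The same triangle, seen from its next corner. -/
def rotate : TriCoords V where
  a := T.b
  b := T.c
  c := T.a
  sgn := T.sgn
  sum_eq_zero p := by linarith [T.sum_eq_zero p]
  eq_of_coords p q hc ha := T.eq_of_coords p q
    (by linarith [T.sum_eq_zero p, T.sum_eq_zero q]) hc
  sgn_ne_zero := T.sgn_ne_zero

/-- The mirror image of the triangle that fixes the corner `A`. Since clockwise and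
counterclockwise change places, the tie-breaking sign changes, too. -/
@[simps]
def mirror : TriCoords V where
  a := T.a
  b := T.c
  c := T.b
  sgn := -T.sgn
  sum_eq_zero p := by linarith [T.sum_eq_zero p]
  eq_of_coords p q hc hb := T.eq_of_coords p q hb hc
  sgn_ne_zero := neg_ne_zero.2 T.sgn_ne_zero

/-- The triangle reflected in a point. -/
@[simps]
def reflect : TriCoords V where
  a p := -T.a p
  b p := -T.b p
  c p := -T.c p
  sgn := T.sgn
  sum_eq_zero p := by linarith [T.sum_eq_zero p]
  eq_of_coords p q hb hc := T.eq_of_coords p q (neg_injective hb) (neg_injective hc)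
  sgn_ne_zero := T.sgn_ne_zero

/-- `p` is in the wedge of `q` at the corner `A`. -/
def InWedge (q p : V) : Prop := T.b q ≤ T.b p ∧ T.c q ≤ T.c p

/-- `p` is first hit when the wedge of `q` at the corner `A` is swept, i.e. when `a` decreases. -/
def FirstHit (q p : V) : Prop :=
  p ∈ S ∧ p ≠ q ∧ T.InWedge q p ∧ ∀ x ∈ S, x ≠ q → T.InWedge q x → T.a x ≤ T.a p

/-- `p` is the nearest neighbour of `q` in its wedge at the corner `A`. -/
def Nearest (q p : V) : Prop :=
  T.FirstHit S q p ∧ ∀ x, T.FirstHit S q x → T.sgn * T.b p ≤ T.sgn * T.b x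

/-- `p` is the nearest neighbour of `q` in one of its three wedges. -/
def SweepsTo (q p : V) : Prop :=
  T.Nearest S q p ∨ T.rotate.Nearest S q p ∨ T.rotate.rotate.Nearest S q p

/-- `p` is first hit in one of the three wedges of `q`. -/
def HitsFirst (q p : V) : Prop :=
  T.FirstHit S q p ∨ T.rotate.FirstHit S q p ∨ T.rotate.rotate.FirstHit S q p

/-- No ties have to be broken at any corner of a point of `S`. -/
def TieFree : Prop :=
  ∀ q ∈ S, ∀ p x, (T.FirstHit S q p → T.FirstHit S q x → p = x) ∧
    (T.rotate.FirstHit S q p → T.rotate.FirstHit S q x → p = x) ∧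
    (T.rotate.rotate.FirstHit S q p → T.rotate.rotate.FirstHit S q x → p = x)

/-- Adjacency in the 3-sweep graph of `S`. -/
def SweepAdj (u v : V) : Prop :=
  u ≠ v ∧ ((u ∈ S ∧ T.SweepsTo S u v) ∨ (v ∈ S ∧ T.SweepsTo S v u))

variable {T S}

theorem eq_of_le {p q : V} (ha : T.a p ≤ T.a q) (hb : T.b p ≤ T.b q) (hc : T.c p ≤ T.c q) :
    p = q :=
  T.eq_of_coords p q (by linarith [T.sum_eq_zero p, T.sum_eq_zero q])
    (by linarith [T.sum_eq_zero p, T.sum_eq_zero q])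

theorem inWedge_mirror {q p : V} : T.mirror.InWedge q p ↔ T.InWedge q p := and_comm

theorem rotate_inWedge {q p : V} : T.rotate.InWedge q p ↔ T.c q ≤ T.c p ∧ T.a q ≤ T.a p := Iff.rfl

theorem InWedge.a_le {q p : V} (h : T.InWedge q p) : T.a p ≤ T.a q := by
  linarith [h.1, h.2, T.sum_eq_zero q, T.sum_eq_zero p]

theorem InWedge.a_lt {q p : V} (h : T.InWedge q p) (hne : p ≠ q) : T.a p < T.a q :=
  h.a_le.lt_of_ne fun ha => hne (eq_of_le ha.ge h.1 h.2).symm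

theorem InWedge.trans {q p x : V} (h : T.InWedge q p) (h' : T.InWedge p x) : T.InWedge q x :=
  ⟨h.1.trans h'.1, h.2.trans h'.2⟩

theorem firstHit_mirror {q p : V} : T.mirror.FirstHit S q p ↔ T.FirstHit S q p := by
  simp only [FirstHit, inWedge_mirror, mirror_a]

theorem FirstHit.a_eq {q p x : V} (h : T.FirstHit S q p) (h' : T.FirstHit S q x) :
    T.a p = T.a x :=
  le_antisymm (h'.2.2.2 p h.1 h.2.1 h.2.2.1) (h.2.2.2 x h'.1 h'.2.1 h'.2.2.1)

theorem FirstHit.of_a_le {q p x : V} (h : T.FirstHit S q p) (hx : x ∈ S) (hxq : x ≠ q)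
    (hqx : T.InWedge q x) (hpx : T.a p ≤ T.a x) : T.FirstHit S q x :=
  ⟨hx, hxq, hqx, fun y hy hyq hqy => (h.2.2.2 y hy hyq hqy).trans hpx⟩

theorem FirstHit.eq_of_b_eq {q p x : V} (h : T.FirstHit S q p) (h' : T.FirstHit S q x)
    (hb : T.b p = T.b x) : p = x :=
  eq_of_le (h.a_eq h').le hb.le
    (by linarith [h.a_eq h', T.sum_eq_zero p, T.sum_eq_zero x])

theorem nearest_mirror {q p : V} : T.mirror.Nearest S q p ↔ T.Nearest S q p := by
  simp only [Nearest, firstHit_mirror]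
  refine and_congr_right fun hp => forall₂_congr fun x hx => ?_
  have hc (y : V) : T.c y = -T.a y - T.b y := by linarith [T.sum_eq_zero y]
  simp only [mirror_sgn, mirror_b, hc, hp.a_eq hx, mul_sub, neg_mul]
  constructor <;> intro h <;> linarith

theorem corners_mirror {P : TriCoords V → Prop} (hP : ∀ T, P T.mirror ↔ P T) :
    (P T.mirror ∨ P T.mirror.rotate ∨ P T.mirror.rotate.rotate) ↔
      (P T ∨ P T.rotate ∨ P T.rotate.rotate) := by
  have hB : P T.mirror.rotate ↔ P T.rotate.rotate := hP T.rotate.rotate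
  have hC : P T.mirror.rotate.rotate ↔ P T.rotate := hP T.rotate
  rw [hP, hB, hC, or_comm (a := P T.rotate)]

theorem sweepsTo_mirror {q p : V} : T.mirror.SweepsTo S q p ↔ T.SweepsTo S q p :=
  corners_mirror (P := fun T => T.Nearest S q p) fun _ => nearest_mirror

theorem hitsFirst_mirror {q p : V} : T.mirror.HitsFirst S q p ↔ T.HitsFirst S q p :=
  corners_mirror (P := fun T => T.FirstHit S q p) fun _ => firstHit_mirror

theorem TieFree.mirror (h : T.TieFree S) : T.mirror.TieFree S := fun q hq p x =>
  ⟨fun hp hx => (h q hq p x).1 (firstHit_mirror.1 hp) (firstHit_mirror.1 hx),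
    fun hp hx => (h q hq p x).2.2 (firstHit_mirror.1 hp) (firstHit_mirror.1 hx),
    fun hp hx => (h q hq p x).2.1 (firstHit_mirror.1 hp) (firstHit_mirror.1 hx)⟩

theorem sweepAdj_mirror {u v : V} : T.mirror.SweepAdj S u v ↔ T.SweepAdj S u v := by
  simp only [SweepAdj, sweepsTo_mirror]

theorem exists_nearest {q x : V} (hx : x ∈ S) (hne : x ≠ q) (h : T.InWedge q x) :
    ∃ p, T.Nearest S q p := by
  classical
  obtain ⟨p, hp, hmax⟩ := (S.filter fun x => x ≠ q ∧ T.InWedge q x).exists_max_image T.a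
    ⟨x, Finset.mem_filter.2 ⟨hx, hne, h⟩⟩
  simp only [Finset.mem_filter, and_imp] at hp hmax
  have hfirst : T.FirstHit S q p := ⟨hp.1, hp.2.1, hp.2.2, hmax⟩
  obtain ⟨w, hw, hmin⟩ := (S.filter fun x => T.FirstHit S q x).exists_min_image
    (fun x => T.sgn * T.b x) ⟨p, Finset.mem_filter.2 ⟨hfirst.1, hfirst⟩⟩
  simp only [Finset.mem_filter, and_imp] at hw hmin
  exact ⟨w, hw.2, fun y hy => hmin y hy.1 hy⟩

theorem Nearest.sweepAdj {u w : V} (hu : u ∈ S) (h : T.Nearest S u w) : T.SweepAdj S u w :=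
  ⟨h.1.2.1.symm, .inl ⟨hu, .inl h⟩⟩

theorem SweepsTo.mem {q p : V} (h : T.SweepsTo S q p) : p ∈ S := by
  rcases h with h | h | h <;> exact h.1.1

theorem SweepAdj.mem_right {u v : V} (h : T.SweepAdj S u v) : v ∈ S :=
  h.2.elim (fun h => h.2.mem) fun h => h.1

variable (T S)

/-- The candidates `v` for left routing from `u` to `t`; right routing is left routing in the
mirror image. -/
def Candidate (t u v : V) : Prop :=
  T.SweepAdj S u v ∧ T.rotate.InWedge t v ∧ T.rotate.InWedge v u

/-- The cross product of `w - u` and `v - u` in the coordinates `b` and `c`; it is positive if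
`v` comes after `w` in the order in which left routing inspects the candidates around `u`. -/
def turn (u w v : V) : ℝ :=
  (T.b w - T.b u) * (T.c v - T.c u) - (T.c w - T.c u) * (T.b v - T.b u)

/-- A step of left routing. -/
def SideStep (t u w : V) : Prop :=
  (T.Candidate S t u w ∧ ∀ v, T.Candidate S t u v → v ≠ w → 0 < T.turn u w v) ∨
  ((¬ ∃ v, T.Candidate S t u v) ∧ T.Nearest S u w)

/-- `t` is an interior point of the wedge of `u` at the corner `A`. -/
def InInterior (u t : V) : Prop := T.b u < T.b t ∧ T.c u < T.c t

/-- A step of the routing algorithm. -/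
def Step (t u w : V) : Prop :=
  (T.InInterior u t ∧ T.Nearest S u w) ∨
  (¬ T.InInterior u t ∧ T.rotate.InWedge t u ∧ T.SideStep S t u w) ∨
  (¬ T.InInterior u t ∧ ¬ T.rotate.InWedge t u ∧ T.mirror.SideStep S t u w)

/-- The invariant of left routing: no point lies in the region in front of `u` bounded by the
lines of `b u`, `a u` and `c t` (`low`). If a point of the `b`-wedge of `t` first hits `u` in
its own `b`-wedge, then `u` loses no tie against a point with smaller `c` (`tie`). -/
structure SideState (t u : V) : Prop where
  mem : u ∈ S
  target_mem : t ∈ S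
  inWedge : T.rotate.InWedge t u
  low : ∀ p ∈ S, T.c t ≤ T.c p → T.b u < T.b p → T.a p ≤ T.a u
  tie : ∀ p ∈ S, T.rotate.InWedge t p → T.rotate.FirstHit S p u →
    ∀ x, T.rotate.FirstHit S p x → T.c x ≤ T.c u → T.sgn * T.c u ≤ T.sgn * T.c x

/-- The invariant of routing while the target is interior to the wedge of the current vertex. -/
structure InnerState (t u : V) : Prop where
  mem : u ∈ S
  target_mem : t ∈ S
  interior : T.InInterior u t

/-- The invariant of the whole algorithm. -/
def State (t u : V) : Prop :=
  T.InnerState S t u ∨ T.SideState S t u ∨ T.mirror.SideState S t u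

/-- The directions of the edges used by left routing (and before it). -/
def SideEdge (u w : V) : Prop := T.b u ≤ T.b w ∧ T.a w ≤ T.a u

variable {T S}

theorem Candidate.b_lt {t u v : V} (h : T.Candidate S t u v) : T.b u < T.b v :=
  h.2.2.a_lt h.1.1

theorem Candidate.mem {t u v : V} (h : T.Candidate S t u v) : v ∈ S := h.1.mem_right

theorem Candidate.cases {t u v : V} (h : T.Candidate S t u v) :
    (T.Nearest S u v ∧ T.c u = T.c v) ∨ (T.rotate.rotate.Nearest S u v ∧ T.a u = T.a v) ∨
      T.rotate.Nearest S v u := by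
  have hlt := h.b_lt
  obtain ⟨hc, ha⟩ := rotate_inWedge.1 h.2.2
  rcases h.1.2 with ⟨-, huv | huv | huv⟩ | ⟨-, hvu | hvu | hvu⟩
  · exact .inl ⟨huv, huv.1.2.2.1.2.antisymm hc⟩
  · exact absurd huv.1.2.2.1.a_le hlt.not_ge
  · exact .inr (.inl ⟨huv, huv.1.2.2.1.1.antisymm ha⟩)
  · exact absurd hvu.1.2.2.1.1 hlt.not_ge
  · exact .inr (.inr hvu)
  · exact absurd hvu.1.2.2.1.2 hlt.not_ge

theorem Candidate.of_nearest {t u v : V} (hv : v ∈ S) (htv : T.rotate.InWedge t v)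
    (h : T.rotate.Nearest S v u) : T.Candidate S t u v :=
  ⟨⟨h.1.2.1, .inr ⟨hv, .inr (.inl h)⟩⟩, htv, h.1.2.2.1⟩

theorem turn_comm {u v w : V} : T.turn u w v = -T.turn u v w := by
  unfold turn
  ring

theorem turn_mirror {u v w : V} : T.mirror.turn u v w = -T.turn u v w := by
  simp only [turn, mirror_b, mirror_c]
  ring

theorem turn_eq {u v w : V} : T.turn u w v =
    (T.c w - T.c u) * (T.a v - T.a w) - (T.a w - T.a u) * (T.c v - T.c w) := by
  unfold turn
  linear_combination (T.c w - T.c v) * T.sum_eq_zero u + (T.c v - T.c u) * T.sum_eq_zero w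
    + (T.c u - T.c w) * T.sum_eq_zero v

/-- Of two candidates in the same direction the farther one, `w`, would have been hidden from `u`
by the nearer one, `v`. -/
theorem Candidate.eq_of_turn_eq_zero {t u v w : V} (hv : T.Candidate S t u v)
    (hw : T.Candidate S t u w) (h0 : T.turn u w v = 0) : v = w := by
  wlog hle : T.b v ≤ T.b w generalizing v w
  · exact (this hw hv (by rw [turn_comm, h0, neg_zero]) (le_of_not_ge hle)).symm
  have hbv := hv.b_lt
  have hbw := hw.b_lt
  obtain ⟨hcv, hav⟩ := rotate_inWedge.1 hv.2.2
  obtain ⟨hcw, haw⟩ := rotate_inWedge.1 hw.2.2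
  have sum_u := T.sum_eq_zero u
  have sum_v := T.sum_eq_zero v
  have sum_w := T.sum_eq_zero w
  have hc : T.c w ≤ T.c v := by
    by_contra! h
    unfold turn at h0
    nlinarith [mul_nonneg (sub_nonneg.2 hle) (sub_nonneg.2 hcw),
      mul_pos (sub_pos.2 hbw) (sub_pos.2 h)]
  have h0a : (T.b w - T.b u) * (T.a v - T.a u) = (T.a w - T.a u) * (T.b v - T.b u) := by
    unfold turn at h0
    linear_combination (-h0) + (T.b w - T.b u) * (sum_v - sum_u)
      - (T.b v - T.b u) * (sum_w - sum_u)
  have ha : T.a w ≤ T.a v := by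
    by_contra! h
    nlinarith [mul_nonneg (sub_nonneg.2 hle) (sub_nonneg.2 haw),
      mul_pos (sub_pos.2 hbw) (sub_pos.2 h)]
  by_contra hne
  have hbvw : T.b v < T.b w := hle.lt_of_ne fun h => hne (eq_of_le (by linarith) hle (by linarith))
  rcases hw.cases with ⟨hn, hcuw⟩ | ⟨hn, hauw⟩ | hn
  · linarith [hn.1.2.2.2 v hv.mem hv.1.1.symm ⟨hbv.le, hcuw.le.trans hc⟩]
  · have hcvw : T.c v ≤ T.c w := hn.1.2.2.2 v hv.mem hv.1.1.symm ⟨hauw.le.trans ha, hbv.le⟩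
    linarith
  · exact (hn.1.2.2.2 v hv.mem hne ⟨hc, ha⟩).not_gt hbv

theorem exists_first_candidate {t u : V} (h : ∃ v, T.Candidate S t u v) :
    ∃ w, T.Candidate S t u w ∧ ∀ v, T.Candidate S t u v → v ≠ w → 0 < T.turn u w v := by
  classical
  obtain ⟨v₀, hv₀⟩ := h
  obtain ⟨w, hw, hmin⟩ := (S.filter fun v => T.Candidate S t u v).exists_min_image
    (fun v => (T.c v - T.c u) / (T.b v - T.b u)) ⟨v₀, Finset.mem_filter.2 ⟨hv₀.mem, hv₀⟩⟩
  simp only [Finset.mem_filter, and_imp] at hw hmin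
  refine ⟨w, hw.2, fun v hv hne => lt_of_le_of_ne ?_ fun h0 =>
    hne (hv.eq_of_turn_eq_zero hw.2 h0.symm)⟩
  have hslope := hmin v hv.mem hv
  rw [div_le_div_iff₀ (sub_pos.2 hw.2.b_lt) (sub_pos.2 hv.b_lt)] at hslope
  unfold turn
  linarith

theorem SideState.of_low {t u : V} (hu : u ∈ S) (ht : t ∈ S) (htu : T.rotate.InWedge t u)
    (hlow : ∀ p ∈ S, T.c t ≤ T.c p → T.b u ≤ T.b p → T.a p ≤ T.a u) : T.SideState S t u where
  mem := hu
  target_mem := ht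
  inWedge := htu
  low p hp hcp hbp := hlow p hp hcp hbp.le
  tie p _ htp hpu x hpx hcx := by
    have hb : T.b u = T.b x := hpu.a_eq hpx
    have ha := hlow x hpx.1 (htp.1.trans hpx.2.2.1.1) hb.le
    have hc : T.c u = T.c x := le_antisymm
      (by linarith [T.sum_eq_zero u, T.sum_eq_zero x]) hcx
    rw [hc]

/-- Behind the first candidate `v`, every point is hidden from `u` by `v`. -/
theorem Candidate.b_le_of_a_lt {t u v x : V} (hv : T.Candidate S t u v) (hx : x ∈ S)
    (hcx : T.c v ≤ T.c x) (hax : T.a v < T.a x) (hxu : T.a x ≤ T.a u) : T.b x ≤ T.b u := by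
  by_contra! hlt
  rcases hv.cases with ⟨hn, hcu⟩ | ⟨-, hau⟩ | hn
  · exact hax.not_ge (hn.1.2.2.2 x hx (by rintro rfl; exact lt_irrefl _ hlt)
      ⟨hlt.le, hcu.le.trans hcx⟩)
  · linarith
  · exact hlt.not_ge (hn.1.2.2.2 x hx (by rintro rfl; exact lt_irrefl _ hax) ⟨hcx, hax.le⟩)

theorem SideState.exists_firstHit {t u v p₀ : V} (h : T.SideState S t u)
    (hv : T.Candidate S t u v) (hp₀ : p₀ ∈ S) (hp₀u : T.a p₀ ≤ T.a u) (htp₀ : T.c t ≤ T.c p₀)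
    (hvp₀ : T.a v < T.a p₀) (hp₀v : T.c p₀ < T.c v) :
    ∃ p ∈ S, T.c t ≤ T.c p ∧ T.a v < T.a p ∧ T.c p < T.c v ∧ T.rotate.FirstHit S p u := by
  classical
  obtain ⟨p, hp, hmin⟩ := (S.filter fun p => T.a p ≤ T.a u ∧ T.c t ≤ T.c p ∧ T.a v < T.a p ∧
    T.c p < T.c v).exists_min_image T.b ⟨p₀, by simp [*]⟩
  simp only [Finset.mem_filter, and_imp] at hp hmin
  obtain ⟨hpS, hpu, htp, hvp, hpv⟩ := hp
  have hcp : T.c p < T.c u := hpv.trans_le hv.2.2.1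
  refine ⟨p, hpS, htp, hvp, hpv, h.mem, fun hup => hcp.ne' (congrArg T.c hup), ⟨hcp.le, hpu⟩,
    fun x hx hxp hpx => ?_⟩
  obtain ⟨hcpx, hapx⟩ := rotate_inWedge.1 hpx
  by_contra! hlt
  have haxu : T.a x ≤ T.a u := h.low x hx (htp.trans hcpx) hlt
  have havx : T.a v < T.a x := hvp.trans_le hapx
  rcases lt_or_ge (T.c x) (T.c v) with hcxv | hcvx
  · have hbpx := hmin x hx haxu (htp.trans hcpx) havx hcxv
    exact hxp (eq_of_le hapx hbpx hcpx).symm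
  · exact hlt.not_ge (hv.b_le_of_a_lt hx hcvx havx haxu)

theorem SideState.nearest_of_firstHit {t u v p : V} (h : T.SideState S t u)
    (hv : T.Candidate S t u v) (hp : p ∈ S) (htp : T.c t ≤ T.c p) (hvp : T.a v < T.a p)
    (hpu : T.rotate.FirstHit S p u) : T.rotate.Nearest S p u := by
  refine ⟨hpu, fun x hpx => ?_⟩
  rcases le_or_gt (T.c x) (T.c u) with hcx | hcx
  · exact h.tie p hp ⟨htp, hv.2.1.2.trans hvp.le⟩ hpu x hpx hcx
  have hbx : T.b u = T.b x := hpu.a_eq hpx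
  have hax : T.a x < T.a u := by linarith [T.sum_eq_zero u, T.sum_eq_zero x]
  have hvx : T.a v < T.a x := hvp.trans_le hpx.2.2.1.2
  rcases hv.cases with ⟨hn, hcu⟩ | ⟨-, hau⟩ | hn
  · exact absurd (hn.1.2.2.2 x hpx.1 (by rintro rfl; exact lt_irrefl _ hcx)
      ⟨hbx.le, hcx.le⟩) hvx.not_ge
  · linarith
  · have hvx_first : T.rotate.FirstHit S v x := hn.1.of_a_le hpx.1
      (by rintro rfl; exact lt_irrefl _ hvx) ⟨hv.2.2.1.trans hcx.le, hvx.le⟩ hbx.le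
    exact hn.2 x hvx_first

theorem SideState.of_first {t u v : V} (h : T.SideState S t u) (hv : T.Candidate S t u v)
    (hfirst : ∀ x, T.Candidate S t u x → x ≠ v → 0 < T.turn u v x) : T.SideState S t v := by
  have hcvu : T.c v ≤ T.c u := hv.2.2.1
  have havu : T.a v ≤ T.a u := hv.2.2.2
  have hbuv := hv.b_lt
  have no_point_between : ∀ p ∈ S, T.a p ≤ T.a u → T.c t ≤ T.c p → T.a v < T.a p →
      T.c v ≤ T.c p := by
    intro p₀ hp₀ hp₀u htp₀ hvp₀
    by_contra! hp₀v
    obtain ⟨p, hp, htp, hvp, hpv, hpu⟩ := h.exists_firstHit hv hp₀ hp₀u htp₀ hvp₀ hp₀v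
    have hcand : T.Candidate S t u p := .of_nearest hp ⟨htp, hv.2.1.2.trans hvp.le⟩
      (h.nearest_of_firstHit hv hp htp hvp hpu)
    have hturn := hfirst p hcand (by rintro rfl; exact lt_irrefl _ hvp)
    have hca : 0 ≤ (T.c u - T.c v) * (T.a p - T.a v) :=
      mul_nonneg (sub_nonneg.2 hcvu) (sub_nonneg.2 hvp.le)
    have hac : 0 ≤ (T.a u - T.a v) * (T.c v - T.c p) :=
      mul_nonneg (sub_nonneg.2 havu) (sub_nonneg.2 hpv.le)
    rw [turn_eq] at hturn
    linarith
  refine .of_low hv.mem h.target_mem hv.2.1 fun p hp htp hbp => ?_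
  by_contra! hlt
  have hpu : T.a p ≤ T.a u := h.low p hp htp (hbuv.trans_le hbp)
  linarith [no_point_between p hp hpu htp hlt, T.sum_eq_zero v, T.sum_eq_zero p]

theorem SideState.exists_inWedge {t u p : V} (h : T.SideState S t u)
    (hno : ¬ ∃ v, T.Candidate S t u v) (hp : p ∈ S) (hpu : p ≠ u) (htp : T.rotate.InWedge t p)
    (hup : T.rotate.InWedge p u) : ∃ x ∈ S, x ≠ u ∧ T.InWedge u x ∧ T.a p ≤ T.a x := by
  classical
  obtain ⟨q, hq, hmin⟩ := (S.filter fun q => q ≠ u ∧ T.rotate.InWedge t q ∧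
    T.rotate.InWedge q u ∧ T.a p ≤ T.a q).exists_min_image T.b ⟨p, by simp [*]⟩
  simp only [Finset.mem_filter, and_imp] at hq hmin
  obtain ⟨hq, hqu, htq, huq, hpq⟩ := hq
  by_contra! hempty
  have hfirst : T.rotate.FirstHit S q u := by
    refine ⟨h.mem, hqu.symm, huq, fun x hx hxq hqx => ?_⟩
    by_contra! hlt
    have hxu : x ≠ u := by rintro rfl; exact lt_irrefl _ hlt
    have hpx : T.a p ≤ T.a x := hpq.trans hqx.2
    have haxu : T.a x ≤ T.a u := h.low x hx (htq.1.trans hqx.1) hlt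
    have hcxu : T.c x < T.c u := by
      by_contra! hc
      exact (hempty x hx hxu ⟨hlt.le, hc⟩).not_ge hpx
    have hbqx := hmin x hx hxu (htq.trans hqx) ⟨hcxu.le, haxu⟩ hpx
    exact hxq (eq_of_le hqx.2 hbqx hqx.1).symm
  refine hno ⟨q, .of_nearest hq htq ⟨hfirst, fun x hx => ?_⟩⟩
  refine h.tie q hq htq hfirst x hx ?_
  by_contra! hc
  have hb : T.b u = T.b x := hfirst.a_eq hx
  exact (hempty x hx.1 (by rintro rfl; exact lt_irrefl _ hc) ⟨hb.le, hc.le⟩).not_ge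
    (hpq.trans hx.2.2.1.2)

theorem SideState.a_le_of_nearest {t u w p : V} (h : T.SideState S t u)
    (hno : ¬ ∃ v, T.Candidate S t u v) (hw : T.Nearest S u w) (hp : p ∈ S) (hpu : p ≠ u)
    (htp : T.rotate.InWedge t p) (hup : T.rotate.InWedge p u) : T.a p ≤ T.a w := by
  obtain ⟨x, hx, hxu, hux, hpx⟩ := h.exists_inWedge hno hp hpu htp hup
  exact hpx.trans (hw.1.2.2.2 x hx hxu hux)

theorem SideState.inWedge_of_nearest {t u w : V} (h : T.SideState S t u) (hne : u ≠ t)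
    (hno : ¬ ∃ v, T.Candidate S t u v) (hw : T.Nearest S u w) : T.rotate.InWedge t w :=
  ⟨h.inWedge.1.trans hw.1.2.2.1.2,
    h.a_le_of_nearest hno hw h.target_mem hne.symm ⟨le_rfl, le_rfl⟩ h.inWedge⟩

theorem SideState.b_eq_of_nearest {t u w p : V} (h : T.SideState S t u) (hne : u ≠ t)
    (hno : ¬ ∃ v, T.Candidate S t u v) (hw : T.Nearest S u w) (hp : p ∈ S)
    (htp : T.c t ≤ T.c p) (hbp : T.b w ≤ T.b p) (hap : T.a w < T.a p) :
    T.b w = T.b u ∧ T.b p = T.b u ∧ T.a u ≤ T.a p := by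
  obtain ⟨-, -, ⟨hbuw, -⟩, hmax⟩ := hw.1
  rcases lt_or_ge (T.a u) (T.a p) with hlt | hge
  · have hpu : T.b p ≤ T.b u := by
      by_contra! hbu
      exact hlt.not_ge (h.low p hp htp hbu)
    exact ⟨by linarith, by linarith, hlt.le⟩
  · by_cases hpu : p = u
    · subst hpu
      exact ⟨by linarith, rfl, le_rfl⟩
    · rcases lt_or_ge (T.c p) (T.c u) with hc | hc
      · have htp' : T.rotate.InWedge t p :=
          ⟨htp, (h.inWedge_of_nearest hne hno hw).2.trans hap.le⟩
        exact absurd (h.a_le_of_nearest hno hw hp hpu htp' ⟨hc.le, hge⟩) hap.not_ge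
      · linarith [hmax p hp hpu ⟨by linarith, hc⟩]

theorem SideState.tie_of_nearest {t u w p x : V} (h : T.SideState S t u) (hne : u ≠ t)
    (hno : ¬ ∃ v, T.Candidate S t u v) (hw : T.Nearest S u w) (hp : p ∈ S)
    (htp : T.rotate.InWedge t p) (hpw : T.rotate.FirstHit S p w) (hpx : T.rotate.FirstHit S p x)
    (hcx : T.c x ≤ T.c w) : T.sgn * T.c w ≤ T.sgn * T.c x := by
  by_contra! hlt
  have hsgn : 0 < T.sgn := by
    by_contra! hneg
    exact hlt.not_ge (mul_le_mul_of_nonpos_left hcx hneg)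
  have hc : T.c x < T.c w := (mul_lt_mul_iff_right₀ hsgn).1 hlt
  have hbwx : T.b w = T.b x := hpw.a_eq hpx
  have hawx : T.a w < T.a x := by linarith [T.sum_eq_zero w, T.sum_eq_zero x]
  obtain ⟨hbwu, hbxu, haux⟩ := h.b_eq_of_nearest hne hno hw hpx.1
    (htp.1.trans hpx.2.2.1.1) hbwx.le hawx
  have hpu : p ≠ u := by
    rintro rfl
    exact hw.1.2.1 (eq_of_le hpw.2.2.1.2 hbwu.ge hw.1.2.2.1.2).symm
  have hcxu : T.c x ≤ T.c u := by linarith [T.sum_eq_zero u, T.sum_eq_zero x]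
  have hup : T.rotate.InWedge p u :=
    ⟨hpx.2.2.1.1.trans hcxu, hpw.2.2.1.2.trans hw.1.2.2.1.a_le⟩
  have hfirst : T.rotate.FirstHit S p u := hpw.of_a_le h.mem hpu.symm hup hbwu.le
  refine hno ⟨p, .of_nearest hp htp ⟨hfirst, fun y hy => ?_⟩⟩
  by_contra! hyu
  exact hyu.not_ge (h.tie p hp htp hfirst y hy ((mul_lt_mul_iff_right₀ hsgn).1 hyu).le)

theorem SideState.of_nearest {t u w : V} (h : T.SideState S t u) (hne : u ≠ t)
    (hno : ¬ ∃ v, T.Candidate S t u v) (hw : T.Nearest S u w) : T.SideState S t w where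
  mem := hw.1.1
  target_mem := h.target_mem
  inWedge := h.inWedge_of_nearest hne hno hw
  low p hp htp hbp := by
    by_contra! hlt
    obtain ⟨hbw, hbpu, -⟩ := h.b_eq_of_nearest hne hno hw hp htp hbp.le hlt
    linarith
  tie _ hp htp hpw _ hpx hcx := h.tie_of_nearest hne hno hw hp htp hpw hpx hcx

theorem SideStep.sweepAdj {t u w : V} (hu : u ∈ S) (h : T.SideStep S t u w) :
    T.SweepAdj S u w :=
  h.elim (fun h => h.1.1) fun h => h.2.sweepAdj hu

theorem SideStep.sideEdge {t u w : V} (h : T.SideStep S t u w) : T.SideEdge u w := by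
  rcases h with ⟨hc, -⟩ | ⟨-, hw⟩
  · exact ⟨hc.b_lt.le, hc.2.2.2⟩
  · exact ⟨hw.1.2.2.1.1, hw.1.2.2.1.a_le⟩

theorem SideState.of_sideStep {t u w : V} (h : T.SideState S t u) (hne : u ≠ t)
    (hw : T.SideStep S t u w) : T.SideState S t w :=
  hw.elim (fun hw => h.of_first hw.1 hw.2) fun hw => h.of_nearest hne hw.1 hw.2

theorem SideState.exists_sideStep {t u : V} (h : T.SideState S t u) (hne : u ≠ t) :
    ∃ w, T.SideStep S t u w := by
  by_cases hc : ∃ v, T.Candidate S t u v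
  · exact (exists_first_candidate hc).imp fun w hw => .inl hw
  · obtain ⟨x, hx, hxu, hux, -⟩ :=
      h.exists_inWedge hc h.target_mem hne.symm ⟨le_rfl, le_rfl⟩ h.inWedge
    exact (exists_nearest hx hxu hux).imp fun w hw => .inr ⟨hc, hw⟩

theorem SideState.not_inInterior {t u : V} (h : T.SideState S t u) : ¬ T.InInterior u t :=
  fun hi => hi.2.not_ge h.inWedge.1

/-- Together the `b`- and the `c`-wedge of `t` cover a half-plane, and they meet only in `t`. -/
theorem not_inWedge_of_mirror {t u : V} (h : T.mirror.rotate.InWedge t u) (hne : u ≠ t) :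
    ¬ T.rotate.InWedge t u :=
  fun h' => hne (eq_of_le h'.2 h.1 h'.1).symm

theorem InnerState.ne {t u : V} (h : T.InnerState S t u) : u ≠ t := by
  rintro rfl
  exact lt_irrefl _ h.interior.1

theorem SideState.of_apex {q t u : V} (hu : u ∈ S) (ht : t ∈ S) (hqu : T.InWedge q u)
    (hqt : T.InWedge q t) (htu : T.c t ≤ T.c u)
    (hlow : ∀ p ∈ S, T.InWedge q p → T.c t ≤ T.c p → T.a p ≤ T.a u) : T.SideState S t u :=
  .of_low hu ht ⟨htu, hlow t ht hqt le_rfl⟩ fun p hp hcp hbp =>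
    hlow p hp ⟨hqu.1.trans hbp, hqt.2.trans hcp⟩ hcp

theorem State.of_apex {q t u : V} (hu : u ∈ S) (ht : t ∈ S) (hqu : T.InWedge q u)
    (hqt : T.InWedge q t)
    (hlow : ∀ p ∈ S, T.InWedge q p → T.c t ≤ T.c p ∨ T.b t ≤ T.b p → T.a p ≤ T.a u) :
    T.State S t u := by
  by_cases hc : T.c t ≤ T.c u
  · exact .inr (.inl (.of_apex hu ht hqu hqt hc fun p hp hqp h => hlow p hp hqp (.inl h)))
  by_cases hb : T.b t ≤ T.b u
  · exact .inr (.inr (.of_apex hu ht hqu.symm hqt.symm hb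
      fun p hp hqp h => hlow p hp hqp.symm (.inr h)))
  · exact .inl ⟨hu, ht, not_le.1 hb, not_le.1 hc⟩

theorem State.of_inWedge {q t : V} (hq : q ∈ S) (ht : t ∈ S) (h : T.InWedge q t) :
    T.State S t q :=
  .of_apex hq ht ⟨le_rfl, le_rfl⟩ h fun _ _ hqp _ => hqp.a_le

theorem InnerState.of_nearest {t u w : V} (h : T.InnerState S t u) (hw : T.Nearest S u w) :
    T.State S t w := by
  obtain ⟨hwS, -, huw, hmax⟩ := hw.1
  obtain ⟨-, ht, hb, hc⟩ := h
  refine .of_apex hwS ht huw ⟨hb.le, hc.le⟩ fun p hp hup hside => hmax p hp ?_ hup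
  rintro rfl
  exact hside.elim hc.not_ge hb.not_ge

theorem State.mem {t u : V} (h : T.State S t u) : u ∈ S := by
  rcases h with h | h | h <;> exact h.mem

theorem InnerState.nearest_of_step {t u w : V} (h : T.InnerState S t u) (hw : T.Step S t u w) :
    T.Nearest S u w := by
  rcases hw with ⟨-, hw⟩ | ⟨hi, -⟩ | ⟨hi, -⟩
  · exact hw
  all_goals exact absurd h.interior hi

theorem SideState.sideStep_of_step {t u w : V} (h : T.SideState S t u) (hw : T.Step S t u w) :
    T.SideStep S t u w := by
  rcases hw with ⟨hi, -⟩ | ⟨-, -, hw⟩ | ⟨-, hn, -⟩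
  · exact absurd hi h.not_inInterior
  · exact hw
  · exact absurd h.inWedge hn

theorem SideState.sideStep_of_step_mirror {t u w : V} (h : T.mirror.SideState S t u) (hne : u ≠ t)
    (hw : T.Step S t u w) : T.mirror.SideStep S t u w := by
  rcases hw with ⟨hi, -⟩ | ⟨-, hB, -⟩ | ⟨-, -, hw⟩
  · exact absurd hi.symm h.not_inInterior
  · exact absurd hB (not_inWedge_of_mirror h.inWedge hne)
  · exact hw

theorem State.sweepAdj {t u w : V} (h : T.State S t u) (hne : u ≠ t) (hw : T.Step S t u w) :
    T.SweepAdj S u w := by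
  rcases h with h | h | h
  · exact (h.nearest_of_step hw).sweepAdj h.mem
  · exact (h.sideStep_of_step hw).sweepAdj h.mem
  · exact sweepAdj_mirror.1 ((h.sideStep_of_step_mirror hne hw).sweepAdj h.mem)

theorem State.exists_step {t u : V} (h : T.State S t u) (hne : u ≠ t) : ∃ w, T.Step S t u w := by
  rcases h with h | h | h
  · obtain ⟨w, hw⟩ := exists_nearest h.target_mem hne.symm ⟨h.interior.1.le, h.interior.2.le⟩
    exact ⟨w, .inl ⟨h.interior, hw⟩⟩
  · exact (h.exists_sideStep hne).imp fun w hw => .inr (.inl ⟨h.not_inInterior, h.inWedge, hw⟩)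
  · exact (h.exists_sideStep hne).imp fun w hw => .inr (.inr
      ⟨fun hi => h.not_inInterior hi.symm, not_inWedge_of_mirror h.inWedge hne, hw⟩)

/-- Iterating `f` from `q` leads to `t`, through vertices that satisfy `P` and along edges that
satisfy `E`. -/
def Reaches (f : V → V) (t : V) (P : V → Prop) (E : V → V → Prop) (q : V) : Prop :=
  ∃ m : ℕ, f^[m] q = t ∧ ∀ j < m, f^[j] q ≠ t ∧ P (f^[j] q) ∧ E (f^[j] q) (f^[j + 1] q)

theorem Reaches.refl (f : V → V) (t : V) (P : V → Prop) (E : V → V → Prop) :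
    Reaches f t P E t :=
  ⟨0, rfl, fun _ hj => absurd hj (Nat.not_lt_zero _)⟩

theorem Reaches.cons {f : V → V} {q t : V} {P : V → Prop} {E : V → V → Prop}
    (h : Reaches f t P E (f q)) (hne : q ≠ t) (hP : P q) (hE : E q (f q)) :
    Reaches f t P E q := by
  obtain ⟨m, hm, hpath⟩ := h
  refine ⟨m + 1, hm, fun j hj => ?_⟩
  cases j with
  | zero => exact ⟨hne, hP, hE⟩
  | succ j => exact hpath j (by omega)

theorem Reaches.mono {f : V → V} {q t : V} {P P' : V → Prop} {E : V → V → Prop}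
    (h : Reaches f t P E q) (hP : ∀ u, P u → P' u) : Reaches f t P' E q :=
  h.imp fun _ hm => ⟨hm.1, fun j hj => (hm.2 j hj).imp_right (And.imp_left (hP _))⟩

theorem SideState.reaches {t q : V} {f : V → V}
    (hf : ∀ u, T.SideState S t u → u ≠ t → T.SideStep S t u (f u)) (hq : T.SideState S t q) :
    Reaches f t (T.SideState S t) T.SideEdge q := by
  have hwf := S.finite_toSet.wellFoundedOn (r := fun v u => T.a v - T.b v < T.a u - T.b u)
  refine hwf.induction
    (P := fun u => T.SideState S t u → Reaches f t (T.SideState S t) T.SideEdge u)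
    hq.mem (fun u _ ih hu => ?_) hq
  by_cases hne : u = t
  · exact hne ▸ .refl ..
  have hstep := hf u hu hne
  have hnext := hu.of_sideStep hne hstep
  obtain ⟨hb, ha⟩ := hstep.sideEdge
  refine (ih (f u) hnext.mem ?_ hnext).cons hne hu ⟨hb, ha⟩
  by_contra! hle
  have haa : T.a (f u) = T.a u := by linarith
  have hbb : T.b (f u) = T.b u := by linarith
  exact (hstep.sweepAdj hu.mem).1 (T.eq_of_coords _ _ hbb.symm
    (by linarith [T.sum_eq_zero u, T.sum_eq_zero (f u), haa]))

theorem State.reaches {t q : V} {f : V → V}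
    (hf : ∀ u, T.State S t u → u ≠ t → T.Step S t u (f u)) (hq : T.State S t q) :
    Reaches f t (T.State S t) T.SideEdge q ∨ Reaches f t (T.State S t) T.mirror.SideEdge q := by
  have hwf := S.finite_toSet.wellFoundedOn (r := fun v u => T.a v < T.a u)
  refine hwf.induction (P := fun u => T.State S t u → Reaches f t (T.State S t) T.SideEdge u ∨
    Reaches f t (T.State S t) T.mirror.SideEdge u) hq.mem (fun u _ ih hu => ?_) hq
  rcases hu with h | h | h
  · have hnear := h.nearest_of_step (hf u (.inl h) h.ne)
    obtain ⟨-, hne, ⟨hb, hc⟩, -⟩ := hnear.1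
    have ha := hnear.1.2.2.1.a_lt hne
    exact (ih (f u) hnear.1.1 ha (h.of_nearest hnear)).imp
      (fun hr => hr.cons h.ne (.inl h) ⟨hb, ha.le⟩) fun hr => hr.cons h.ne (.inl h) ⟨hc, ha.le⟩
  · exact .inl ((h.reaches fun v hv hne => hv.sideStep_of_step (hf v (.inr (.inl hv)) hne)).mono
      fun v hv => .inr (.inl hv))
  · exact .inr ((h.reaches fun v hv hne =>
      hv.sideStep_of_step_mirror hne (hf v (.inr (.inr hv)) hne)).mono fun v hv => .inr (.inr hv))

variable {S' : Finset V} {G G' : SimpleGraph V}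

theorem sideStep_congr {t u w : V} (hA : ∀ v, T.Nearest S u v ↔ T.Nearest S' u v)
    (hB : ∀ v, T.Candidate S t u v ↔ T.Candidate S' t u v) :
    T.SideStep S t u w ↔ T.SideStep S' t u w := by
  simp only [SideStep, hA, hB]

theorem step_congr {t u w : V} (hA : ∀ v, T.Nearest S u v ↔ T.Nearest S' u v)
    (hB : T.rotate.InWedge t u → ∀ v, T.Candidate S t u v ↔ T.Candidate S' t u v)
    (hC : ¬ T.InInterior u t → ¬ T.rotate.InWedge t u →
      ∀ v, T.mirror.Candidate S t u v ↔ T.mirror.Candidate S' t u v) :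
    T.Step S t u w ↔ T.Step S' t u w :=
  or_congr (and_congr_right fun _ => hA w) <| or_congr
    (and_congr_right fun _ => and_congr_right fun h => sideStep_congr hA (hB h))
    (and_congr_right fun hi => and_congr_right fun h => sideStep_congr
      (fun _ => by rw [nearest_mirror, nearest_mirror, hA]) (hC hi h))

variable (T S G) in
/-- `G` contains the 3-sweep graph of `S` and has no edges outside `S`. Such graphs are the ones in
which routing takes place. -/
structure CarriesSweep : Prop where
  adj {u v : V} : T.SweepAdj S u v → G.Adj u v
  mem_right {u v : V} : G.Adj u v → v ∈ S

theorem sweepAdj_rotate {u v : V} : T.rotate.SweepAdj S u v ↔ T.SweepAdj S u v :=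
  and_congr_right fun _ => or_congr (and_congr_right fun _ => or_rotate.symm)
    (and_congr_right fun _ => or_rotate.symm)

theorem CarriesSweep.rotate (h : T.CarriesSweep S G) : T.rotate.CarriesSweep S G :=
  ⟨fun huv => h.adj (sweepAdj_rotate.1 huv), h.mem_right⟩

theorem CarriesSweep.mirror (h : T.CarriesSweep S G) : T.mirror.CarriesSweep S G :=
  ⟨fun huv => h.adj (sweepAdj_mirror.1 huv), h.mem_right⟩

theorem Nearest.of_mem {u w : V} (hS : ∀ x, T.Nearest S u x → x ∈ S')
    (hS' : ∀ x, T.Nearest S' u x → x ∈ S) (h : T.Nearest S u w) : T.Nearest S' u w := by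
  have hw := hS w h
  obtain ⟨x, hx⟩ := exists_nearest hw h.1.2.1 h.1.2.2.1
  have hwx : T.a w ≤ T.a x := hx.1.2.2.2 w hw h.1.2.1 h.1.2.2.1
  have hxw : T.a x ≤ T.a w := h.1.2.2.2 x (hS' x hx) hx.1.2.1 hx.1.2.2.1
  have hfirst : T.FirstHit S u x := h.1.of_a_le (hS' x hx) hx.1.2.1 hx.1.2.2.1 hwx
  have hfirst' : T.FirstHit S' u w := hx.1.of_a_le hw h.1.2.1 h.1.2.2.1 hxw
  have hb : T.b w = T.b x :=
    mul_left_cancel₀ T.sgn_ne_zero (le_antisymm (h.2 x hfirst) (hx.2 w hfirst'))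
  exact h.1.eq_of_b_eq hfirst hb ▸ hx

theorem CarriesSweep.nearest_iff {u w : V} (hG : T.CarriesSweep S G) (hG' : T.CarriesSweep S' G')
    (hu : u ∈ S) (hu' : u ∈ S') (hN : ∀ v, G.Adj u v ↔ G'.Adj u v) :
    T.Nearest S u w ↔ T.Nearest S' u w := by
  have hS (x) (hx : T.Nearest S u x) : x ∈ S' := hG'.mem_right ((hN x).1 (hG.adj (hx.sweepAdj hu)))
  have hS' (x) (hx : T.Nearest S' u x) : x ∈ S :=
    hG.mem_right ((hN x).2 (hG'.adj (hx.sweepAdj hu')))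
  exact ⟨.of_mem hS hS', .of_mem hS' hS⟩

theorem CarriesSweep.sweepsTo_iff {u w : V} (hG : T.CarriesSweep S G)
    (hG' : T.CarriesSweep S' G') (hu : u ∈ S) (hu' : u ∈ S') (hN : ∀ v, G.Adj u v ↔ G'.Adj u v) :
    T.SweepsTo S u w ↔ T.SweepsTo S' u w :=
  or_congr (hG.nearest_iff hG' hu hu' hN) <| or_congr (hG.rotate.nearest_iff hG'.rotate hu hu' hN)
    (hG.rotate.rotate.nearest_iff hG'.rotate.rotate hu hu' hN)

theorem CarriesSweep.sweepAdj_of_sweepAdj {u v : V} (hG : T.CarriesSweep S G)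
    (hG' : T.CarriesSweep S' G') (hu' : u ∈ S') (hN : ∀ v, G.Adj u v ↔ G'.Adj u v)
    (hN' : ∀ v, G.Adj u v → ∀ x, G.Adj v x ↔ G'.Adj v x) (h : T.SweepAdj S u v) :
    T.SweepAdj S' u v := by
  have huv := hG.adj h
  have hv' := hG'.mem_right ((hN v).1 huv)
  exact ⟨h.1, h.2.imp (fun ⟨hu, h⟩ => ⟨hu', (hG.sweepsTo_iff hG' hu hu' hN).1 h⟩)
    fun ⟨hv, h⟩ => ⟨hv', (hG.sweepsTo_iff hG' hv hv' (hN' v huv)).1 h⟩⟩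

theorem CarriesSweep.step_iff_of_two_neighborhood {t u w : V} (hG : T.CarriesSweep S G)
    (hG' : T.CarriesSweep S' G') (hu : u ∈ S) (hu' : u ∈ S') (hN : ∀ v, G.Adj u v ↔ G'.Adj u v)
    (hN' : ∀ v, G.Adj u v → ∀ x, G.Adj v x ↔ G'.Adj v x) :
    T.Step S t u w ↔ T.Step S' t u w := by
  have hadj (v) : T.SweepAdj S u v ↔ T.SweepAdj S' u v :=
    ⟨hG.sweepAdj_of_sweepAdj hG' hu' hN hN', hG'.sweepAdj_of_sweepAdj hG hu (fun v => (hN v).symm)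
      fun v hv x => (hN' v ((hN v).2 hv) x).symm⟩
  refine step_congr (fun _ => hG.nearest_iff hG' hu hu' hN) (fun _ v => ?_) fun _ _ v => ?_
  · simp only [Candidate, hadj]
  · simp only [Candidate, sweepAdj_mirror, hadj]

variable (T S G) in
/-- `S` is tie-free, and the edges of `G` outside the 3-sweep graph of `S` come from sweeps with the
reflected triangle. In such graphs the candidates can be recognized from the neighbours of the
current vertex alone. -/
structure CarriesTieFreeSweep : Prop extends T.CarriesSweep S G where
  tieFree : T.TieFree S
  cases {u v : V} : G.Adj u v →
    T.SweepAdj S u v ∨ T.reflect.HitsFirst S u v ∨ T.reflect.HitsFirst S v u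

theorem CarriesTieFreeSweep.mirror (h : T.CarriesTieFreeSweep S G) :
    T.mirror.CarriesTieFreeSweep S G where
  toCarriesSweep := h.toCarriesSweep.mirror
  tieFree := h.tieFree.mirror
  cases huv := (h.cases huv).imp sweepAdj_mirror.2
    (Or.imp (hitsFirst_mirror (T := T.reflect)).2 (hitsFirst_mirror (T := T.reflect)).2)

theorem Candidate.a_lt_of_inWedge {t u v w : V} (hv : T.Candidate S t u v) (hties : T.TieFree S)
    (hu : u ∈ S) (hw : w ∈ S) (hwu : w ≠ u) (huw : T.InWedge u w) (hwv : w ≠ v) :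
    T.a w < T.a v := by
  by_contra! hle
  rcases hv.cases with ⟨hn, -⟩ | ⟨-, hau⟩ | hn
  · exact hwv ((hties u hu w v).1 (hn.1.of_a_le hw hwu huw hle) hn.1)
  · linarith [huw.a_lt hwu]
  · exact hwu ((hties v hv.mem w u).2.1
      (hn.1.of_a_le hw hwv ⟨hv.2.2.1.trans huw.2, hle⟩ huw.1) hn.1)

theorem SideState.firstHit_of_reflect {t u v : V} (h : T.SideState S t u) (hne : u ≠ v)
    (htv : T.rotate.InWedge t v) (hvu : T.rotate.InWedge v u)
    (hbefore : ∀ x ∈ S, x ≠ u → T.InWedge u x → T.a x < T.a v)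
    (hrefl : T.reflect.HitsFirst S u v ∨ T.reflect.HitsFirst S v u) : T.rotate.FirstHit S v u := by
  have hbuv : T.b u < T.b v := hvu.a_lt hne
  refine ⟨h.mem, hne, hvu, fun x hx hxv hvx => ?_⟩
  by_contra! hlt
  obtain ⟨hcvx, havx⟩ := rotate_inWedge.1 hvx
  have haxu : T.a x ≤ T.a u := h.low x hx (htv.1.trans hcvx) hlt
  have hxu : x ≠ u := by rintro rfl; exact lt_irrefl _ hlt
  have hcxu : T.c x < T.c u := by
    by_contra! hc
    exact (hbefore x hx hxu ⟨hlt.le, hc⟩).not_ge havx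
  have hcvu : T.c v < T.c u := hcvx.trans_lt hcxu
  rcases hrefl with (⟨-, -, ⟨hb, -⟩, -⟩ | ⟨-, -, -, hmin⟩ | ⟨-, -, ⟨-, hb⟩, -⟩) |
    (⟨-, -, ⟨-, hc⟩, -⟩ | ⟨-, -, ⟨hc, -⟩, -⟩ | ⟨-, -, ⟨ha, -⟩, hmin⟩)
  · exact hbuv.not_ge (neg_le_neg_iff.1 hb)
  · have hbvx := neg_le_neg_iff.1 (hmin x hx hxu ⟨neg_le_neg hcxu.le, neg_le_neg haxu⟩)
    exact hxv (eq_of_le havx hbvx hcvx).symm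
  · exact hbuv.not_ge (neg_le_neg_iff.1 hb)
  · exact hcvu.not_ge (neg_le_neg_iff.1 hc)
  · exact hcvu.not_ge (neg_le_neg_iff.1 hc)
  · have hbxv : T.b x ≤ T.b v := hvx.a_le
    have hcux := hmin x hx hxv ⟨neg_le_neg (haxu.trans (neg_le_neg_iff.1 ha)), neg_le_neg hbxv⟩
    exact hcxu.not_ge (neg_le_neg_iff.1 hcux)

theorem SideState.candidate_iff {t u v : V} (h : T.SideState S t u)
    (hG : T.CarriesTieFreeSweep S G) :
    T.Candidate S t u v ↔ G.Adj u v ∧ T.rotate.InWedge t v ∧ T.rotate.InWedge v u ∧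
      ∀ w, G.Adj u w → T.InWedge u w → w ≠ v → T.a w < T.a v := by
  refine ⟨fun hv => ⟨hG.adj hv.1, hv.2.1, hv.2.2, fun w hw huw hwv =>
    hv.a_lt_of_inWedge hG.tieFree h.mem (hG.mem_right hw) hw.ne' huw hwv⟩, ?_⟩
  rintro ⟨hadj, htv, hvu, hcrit⟩
  have hvS := hG.mem_right hadj
  by_contra hcand
  have hnot : ¬ T.SweepAdj S u v := fun huv => hcand ⟨huv, htv, hvu⟩
  have hbefore (x) (hx : x ∈ S) (hxu : x ≠ u) (hux : T.InWedge u x) : T.a x < T.a v := by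
    obtain ⟨w, hw⟩ := exists_nearest hx hxu hux
    have huw := hw.sweepAdj h.mem
    exact (hw.1.2.2.2 x hx hxu hux).trans_lt
      (hcrit w (hG.adj huw) hw.1.2.2.1 fun hwv => hnot (hwv ▸ huw))
  have hfirst := h.firstHit_of_reflect hadj.ne htv hvu hbefore ((hG.cases hadj).resolve_left hnot)
  exact hcand (.of_nearest hvS htv ⟨hfirst, fun x hx =>
    ((hG.tieFree v hvS u x).2.1 hfirst hx) ▸ le_rfl⟩)

theorem State.sideState {t u : V} (h : T.State S t u) (hne : u ≠ t)
    (htu : T.rotate.InWedge t u) : T.SideState S t u := by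
  rcases h with h | h | h
  · exact absurd htu.1 h.interior.2.not_ge
  · exact h
  · exact absurd htu (not_inWedge_of_mirror h.inWedge hne)

theorem State.sideState_mirror {t u : V} (h : T.State S t u) (hi : ¬ T.InInterior u t)
    (htu : ¬ T.rotate.InWedge t u) : T.mirror.SideState S t u := by
  rcases h with h | h | h
  · exact absurd h.interior hi
  · exact absurd h.inWedge htu
  · exact h

theorem CarriesTieFreeSweep.step_iff_of_neighborhood {t u w : V} (hG : T.CarriesTieFreeSweep S G)
    (hG' : T.CarriesTieFreeSweep S' G') (hu : T.State S t u) (hu' : T.State S' t u) (hne : u ≠ t)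
    (hN : ∀ v, G.Adj u v ↔ G'.Adj u v) : T.Step S t u w ↔ T.Step S' t u w := by
  refine step_congr (fun _ => hG.nearest_iff hG'.toCarriesSweep hu.mem hu'.mem hN)
    (fun htu v => ?_) fun hi htu v => ?_
  · simp only [(hu.sideState hne htu).candidate_iff hG,
      (hu'.sideState hne htu).candidate_iff hG', hN]
  · simp only [(hu.sideState_mirror hi htu).candidate_iff hG.mirror,
      (hu'.sideState_mirror hi htu).candidate_iff hG'.mirror, hN]

end TriCoords

theorem plane_ext {p q : Plane} (h0 : p 0 = q 0) (h1 : p 1 = q 1) : p = q := by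
  ext i
  fin_cases i
  exacts [h0, h1]

theorem cross_swap (u v : Plane) : cross u v = -cross v u := by
  simp only [cross]
  ring

theorem cross_neg_left (u v : Plane) : cross (-u) v = -cross u v := by
  simp only [cross, PiLp.neg_apply]
  ring

theorem cross_sub_right (u v w : Plane) : cross u (v - w) = cross u v - cross u w := by
  simp only [cross, PiLp.sub_apply]
  ring

theorem cross_sub_left (u v w : Plane) : cross (u - v) w = cross u w - cross v w := by
  simp only [cross, PiLp.sub_apply]
  ring

theorem continuous_cross (u : Plane) : Continuous (cross u) := by
  unfold cross
  fun_prop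

theorem cross_smul_eq (u v p : Plane) : cross u v • p = cross u p • v - cross v p • u := by
  apply plane_ext <;> simp only [cross, PiLp.sub_apply, PiLp.smul_apply, smul_eq_mul] <;> ring

theorem eq_of_cross_eq {u v p q : Plane} (h : cross u v ≠ 0) (hu : cross u p = cross u q)
    (hv : cross v p = cross v q) : p = q := by
  refine smul_right_injective Plane h ?_
  simp only [cross_smul_eq u v p, cross_smul_eq u v q, hu, hv]

theorem cross_rotate (X Y Z : Plane) : cross (Z - Y) (X - Y) = cross (Y - X) (Z - X) := by
  simp only [cross, PiLp.sub_apply]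
  ring

theorem mem_wedge_iff_cross {X Y Z q p : Plane} (h : cross (Y - X) (Z - X) < 0) :
    p ∈ wedge X Y Z q ↔ 0 ≤ cross (Z - X) (p - q) ∧ 0 ≤ cross (X - Y) (p - q) := by
  have hXY (v : Plane) : cross (X - Y) v = -cross (Y - X) v := by
    rw [← cross_neg_left, neg_sub]
  rw [hXY, neg_nonneg]
  constructor
  · rintro ⟨s, r, hs, hr, rfl⟩
    have hb : cross (Z - X) (q + s • (Y - X) + r • (Z - X) - q) =
        s * -cross (Y - X) (Z - X) := by
      simp [cross]
      ring
    have hc : cross (Y - X) (q + s • (Y - X) + r • (Z - X) - q) =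
        r * cross (Y - X) (Z - X) := by
      simp [cross]
      ring
    rw [hb, hc]
    exact ⟨mul_nonneg hs (neg_nonneg.2 h.le), mul_nonpos_of_nonneg_of_nonpos hr h.le⟩
  · rintro ⟨hb, hc⟩
    refine ⟨_, _, div_nonneg_of_nonpos (neg_nonpos.2 hb) h.le, div_nonneg_of_nonpos hc h.le, ?_⟩
    rw [add_assoc, ← sub_eq_iff_eq_add']
    refine smul_right_injective Plane h.ne ?_
    simp only [cross_smul_eq _ _ (p - q), smul_add, smul_smul, mul_div_cancel₀ _ h.ne]
    module

theorem exists_pos_sub_smul_mem {s : Set Plane} {p : Plane} (hp : p ∈ interior s) (v : Plane) :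
    ∃ ε : ℝ, 0 < ε ∧ p - ε • v ∈ s := by
  have hcont : Continuous fun ε : ℝ => p - ε • v := by fun_prop
  have hev : ∀ᶠ ε in nhds (0 : ℝ), p - ε • v ∈ s :=
    hcont.continuousAt.eventually_mem (by simpa using mem_interior_iff_mem_nhds.1 hp)
  have hpos : ∀ᶠ ε in nhdsWithin (0 : ℝ) (Set.Ioi 0), 0 < ε := eventually_mem_nhdsWithin
  exact (hpos.and (hev.filter_mono nhdsWithin_le_nhds)).exists

/-- The coordinates of a triangle `XYZ` in the plane, listed clockwise. Up to additive constants and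
a common factor they are the barycentric coordinates; as `Z` is clockwise of `Y`, small values of
`b` win ties. -/
@[simps]
noncomputable def planeCoords (X Y Z : Plane) (h : cross (Y - X) (Z - X) < 0) :
    TriCoords Plane where
  a := cross (Y - Z)
  b := cross (Z - X)
  c := cross (X - Y)
  sgn := 1
  sum_eq_zero p := by
    simp only [cross_sub_left]
    ring
  eq_of_coords p q hb hc := by
    refine eq_of_cross_eq (u := Z - X) (v := X - Y) ?_ hb hc
    rw [← neg_sub Y X, cross_swap, cross_neg_left, neg_neg]
    exact h.ne
  sgn_ne_zero := one_ne_zero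

section PlaneCoords

variable {X Y Z : Plane} (h : cross (Y - X) (Z - X) < 0) {S : Finset Plane} {q p : Plane}
include h

theorem mem_wedge_iff : p ∈ wedge X Y Z q ↔ (planeCoords X Y Z h).InWedge q p := by
  rw [mem_wedge_iff_cross h, cross_sub_right, cross_sub_right, sub_nonneg, sub_nonneg]
  rfl

theorem sweepTime_eq :
    sweepTime Y Z q p = (planeCoords X Y Z h).a q - (planeCoords X Y Z h).a p := by
  simp only [sweepTime, planeCoords_a, cross, PiLp.sub_apply]
  ring

theorem isFirstHit_iff : IsFirstHit X Y Z S q p ↔ (planeCoords X Y Z h).FirstHit S q p := by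
  simp only [IsFirstHit, TriCoords.FirstHit, mem_wedge_iff h, sweepTime_eq h, sub_le_sub_iff_left]

theorem turn_planeCoords (u w v : Plane) : (planeCoords X Y Z h).turn u w v =
    cross (Y - X) (Z - X) * cross (w - u) (v - u) := by
  simp only [TriCoords.turn, planeCoords_b, planeCoords_c, cross, PiLp.sub_apply]
  ring

theorem isNearest_iff : IsNearest X Y Z S q p ↔ (planeCoords X Y Z h).Nearest S q p := by
  set T := planeCoords X Y Z h with hT
  simp only [IsNearest, TriCoords.Nearest, isFirstHit_iff h, ← hT]
  refine and_congr_right fun hp => forall₂_congr fun x hx => ?_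
  have hturn : T.turn q x p = (T.a q - T.a p) * (T.b x - T.b p) := by
    rw [TriCoords.turn_eq, hx.a_eq hp]
    linear_combination (T.a p - T.a q) * (T.sum_eq_zero x - T.sum_eq_zero p - hx.a_eq hp)
  have hlt : T.a p < T.a q := hp.2.2.1.a_lt hp.2.1
  rw [turn_planeCoords] at hturn
  rw [show T.sgn = 1 from rfl, one_mul, one_mul, ← sub_nonneg (b := T.b p),
    ← mul_nonneg_iff_of_pos_left (sub_pos.2 hlt), ← hturn]
  exact ⟨mul_nonneg_of_nonpos_of_nonpos h.le, fun hprod => nonpos_of_mul_nonneg_right hprod h⟩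

theorem sweepsTo_iff :
    SweepsTo X Y Z S q p ↔ q ∈ S ∧ (planeCoords X Y Z h).SweepsTo S q p := by
  have hY : cross (Z - Y) (X - Y) < 0 := cross_rotate X Y Z ▸ h
  have hZ : cross (X - Z) (Y - Z) < 0 := cross_rotate Y Z X ▸ hY
  rw [SweepsTo, isNearest_iff h, isNearest_iff hY, isNearest_iff hZ]
  rfl

theorem threeSweep_adj_iff :
    (threeSweep X Y Z S).Adj q p ↔ (planeCoords X Y Z h).SweepAdj S q p := by
  simp only [threeSweep, sweepsTo_iff h]
  rfl

theorem mem_interior_wedge_iff :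
    p ∈ interior (wedge X Y Z q) ↔ (planeCoords X Y Z h).InInterior q p := by
  set T := planeCoords X Y Z h
  constructor
  · intro hp
    obtain ⟨ε, hε, hmem⟩ := exists_pos_sub_smul_mem hp ((Y - X) + (Z - X))
    obtain ⟨hb, hc⟩ := (mem_wedge_iff h).1 hmem
    have hb' : T.b (p - ε • ((Y - X) + (Z - X))) = T.b p + ε * cross (Y - X) (Z - X) := by
      simp [T, cross]
      ring
    have hc' : T.c (p - ε • ((Y - X) + (Z - X))) = T.c p + ε * cross (Y - X) (Z - X) := by
      simp [T, cross]
      ring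
    have hneg := mul_neg_of_pos_of_neg hε h
    exact ⟨by linarith, by linarith⟩
  · intro hp
    refine mem_interior.2 ⟨{x | T.b q < T.b x} ∩ {x | T.c q < T.c x},
      fun x hx => (mem_wedge_iff h).2 ⟨hx.1.le, hx.2.le⟩, ?_, hp⟩
    exact (isOpen_lt continuous_const (continuous_cross _)).inter
      (isOpen_lt continuous_const (continuous_cross _))

end PlaneCoords

theorem inner_plane (u v : Plane) : inner ℝ u v = u 0 * v 0 + u 1 * v 1 := by
  simp only [PiLp.inner_apply, Fin.sum_univ_two, RCLike.inner_apply, conj_trivial]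
  ring

theorem norm_unit (φ : ℝ) : ‖unit φ‖ = 1 := by
  simp [EuclideanSpace.norm_eq, unit]

theorem inner_unit (φ ψ : ℝ) : inner ℝ (unit φ) (unit ψ) = Real.cos (φ - ψ) := by
  simp [inner_plane, unit, Real.cos_sub]

theorem cross_unit (φ ψ : ℝ) : cross (unit φ) (unit ψ) = Real.sin (ψ - φ) := by
  simp only [cross, unit, Real.sin_sub, PiLp.toLp_apply, Matrix.cons_val_zero, Matrix.cons_val_one]
  ring

theorem cross_unit_add (φ β : ℝ) (v : Plane) : cross (unit (φ + β)) v =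
    Real.cos β * cross (unit φ) v - Real.sin β * inner ℝ (unit φ) v := by
  simp only [cross, inner_plane, unit, Real.cos_add, Real.sin_add, PiLp.toLp_apply,
    Matrix.cons_val_zero, Matrix.cons_val_one]
  ring

theorem cross_unit_sub (φ β : ℝ) (v : Plane) : cross (unit (φ - β)) v =
    Real.cos β * cross (unit φ) v + Real.sin β * inner ℝ (unit φ) v := by
  rw [sub_eq_add_neg, cross_unit_add, Real.cos_neg, Real.sin_neg, neg_mul, sub_neg_eq_add]

theorem inner_sq_add_cross_sq (φ : ℝ) (v : Plane) :
    inner ℝ (unit φ) v ^ 2 + cross (unit φ) v ^ 2 = ‖v‖ ^ 2 := by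
  simp only [EuclideanSpace.real_norm_sq_eq, Fin.sum_univ_two, inner_plane, cross, unit,
    PiLp.toLp_apply, Matrix.cons_val_zero, Matrix.cons_val_one]
  linear_combination (v 0 ^ 2 + v 1 ^ 2) * Real.cos_sq_add_sin_sq φ

theorem unit_add_int_mul_two_pi (φ : ℝ) (n : ℤ) : unit (φ + n * (2 * Real.pi)) = unit φ := by
  simp [unit, Real.cos_add_int_mul_two_pi, Real.sin_add_int_mul_two_pi]

theorem unit_add_pi (φ : ℝ) : unit (φ + Real.pi) = -unit φ := by
  apply plane_ext <;> simp [unit]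

theorem unit_sub_pi (φ : ℝ) : unit (φ - Real.pi) = -unit φ := by
  apply plane_ext <;> simp [unit]

theorem unit_sub_add_unit_add (φ : ℝ) :
    unit (φ - Real.pi / 3) + unit (φ + Real.pi / 3) = unit φ := by
  apply plane_ext <;> simp [unit, Real.cos_add, Real.cos_sub, Real.sin_add, Real.sin_sub] <;> ring

theorem exists_polar (v : Plane) : ∃ φ : ℝ, v = ‖v‖ • unit φ := by
  have hv : ‖v‖ = ‖(⟨v 0, v 1⟩ : ℂ)‖ := by
    rw [EuclideanSpace.norm_eq, Fin.sum_univ_two, Complex.norm_eq_sqrt_sq_add_sq, Real.norm_eq_abs,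
      Real.norm_eq_abs, sq_abs, sq_abs]
  refine ⟨Complex.arg ⟨v 0, v 1⟩, ?_⟩
  rw [hv]
  apply plane_ext
  · simp [unit, Complex.norm_mul_cos_arg]
  · simp [unit, Complex.norm_mul_sin_arg]

theorem mem_cone_iff {φ γ : ℝ} (h0 : 0 < γ) (hπ : γ < Real.pi) {v : Plane} :
    v ∈ cone φ γ ↔ 0 ≤ cross (unit (φ - γ / 2)) v ∧ cross (unit (φ + γ / 2)) v ≤ 0 := by
  have hcos : 0 < Real.cos (γ / 2) := Real.cos_pos_of_mem_Ioo ⟨by linarith, by linarith⟩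
  have hsin : 0 < Real.sin (γ / 2) := Real.sin_pos_of_pos_of_lt_pi (by linarith) (by linarith)
  have hsq : inner ℝ (unit φ) v ^ 2 - (‖v‖ * Real.cos (γ / 2)) ^ 2 =
      (Real.sin (γ / 2) * inner ℝ (unit φ) v) ^ 2 -
        (Real.cos (γ / 2) * cross (unit φ) v) ^ 2 := by
    rw [mul_pow ‖v‖, ← inner_sq_add_cross_sq φ v, mul_pow (Real.sin _), Real.sin_sq]
    ring
  rw [cross_unit_sub, cross_unit_add, ← neg_le_iff_add_nonneg, sub_nonpos, ← abs_le]
  change ‖v‖ * Real.cos (γ / 2) ≤ inner ℝ (unit φ) v ↔ _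
  constructor <;> intro h
  · have hv : 0 ≤ ‖v‖ * Real.cos (γ / 2) := by positivity
    have hle := pow_le_pow_left₀ hv h 2
    exact abs_le_of_sq_le_sq (by linarith) (mul_nonneg hsin.le (hv.trans h))
  · have hinner : 0 ≤ inner ℝ (unit φ) v :=
      nonneg_of_mul_nonneg_right ((abs_nonneg _).trans h) hsin
    have hle := sq_le_sq' (abs_le.1 h).1 (abs_le.1 h).2
    exact le_of_sq_le_sq (by linarith) hinner

theorem cone_congr {φ ψ : ℝ} (h : unit φ = unit ψ) (γ : ℝ) : cone φ γ = cone ψ γ := by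
  rw [cone, cone, h]

theorem pathLength_le_of_mem_cone {φ γ : ℝ} (hγ : 0 < Real.cos (γ / 2)) {x : ℕ → Plane} {m : ℕ}
    (h : ∀ j < m, x (j + 1) - x j ∈ cone φ γ) :
    pathLength x m ≤ 1 / Real.cos (γ / 2) * dist (x 0) (x m) := by
  rw [one_div, inv_mul_eq_div, le_div_iff₀ hγ]
  calc pathLength x m * Real.cos (γ / 2)
      ≤ ∑ j ∈ Finset.range m, inner ℝ (unit φ) (x (j + 1) - x j) := by
        rw [pathLength, Finset.sum_mul]
        refine Finset.sum_le_sum fun j hj => ?_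
        rw [dist_comm, dist_eq_norm]
        exact h j (Finset.mem_range.1 hj)
    _ = inner ℝ (unit φ) (x m - x 0) := by rw [← inner_sum, Finset.sum_range_sub]
    _ ≤ ‖unit φ‖ * ‖x m - x 0‖ := real_inner_le_norm _ _
    _ = dist (x 0) (x m) := by rw [norm_unit, one_mul, dist_comm, dist_eq_norm]

/-- The direction of the bisector of the `n`-th of `k` cones of angle `2π/k`, in counterclockwise
order; `n` counts modulo `k`. -/
noncomputable def axis (k : ℕ) (n : ℤ) : ℝ := Real.pi / 2 + n * (2 * Real.pi / k)

theorem unit_axis_congr {k : ℕ} (hk : k ≠ 0) {m n : ℤ} (h : m ≡ n [ZMOD k]) :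
    unit (axis k m) = unit (axis k n) := by
  obtain ⟨r, hr⟩ := h.dvd
  have hn : (n : ℝ) = m + k * r := by exact_mod_cast eq_add_of_sub_eq' hr
  rw [← unit_add_int_mul_two_pi (axis k m) r, axis, axis, hn]
  congr 1
  field_simp
  ring

theorem exists_fin_modEq {k : ℕ} (hk : k ≠ 0) (n : ℤ) : ∃ j : Fin k, (j : ℤ) ≡ n [ZMOD k] := by
  have hk' : (k : ℤ) ≠ 0 := Nat.cast_ne_zero.2 hk
  have hn := Int.toNat_of_nonneg (Int.emod_nonneg n hk')
  refine ⟨⟨(n % k).toNat, ?_⟩, ?_⟩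
  · have := Int.emod_lt_of_pos n (by positivity : 0 < (k : ℤ))
    omega
  · rw [Fin.val_mk, hn]
    exact Int.mod_modEq n k

theorem exists_mem_cone_axis {k : ℕ} (hk : k ≠ 0) (v : Plane) :
    ∃ n : ℤ, v ∈ cone (axis k n) (2 * Real.pi / k) := by
  obtain ⟨φ, hφ⟩ := exists_polar v
  have hpos : (0 : ℝ) < 2 * Real.pi / k := by positivity
  set x := (φ - Real.pi / 2) / (2 * Real.pi / k) with hx
  have hangle : |axis k (round x) - φ| ≤ 2 * Real.pi / k / 2 := by
    have hsub : axis k (round x) - φ = -((x - round x) * (2 * Real.pi / k)) := by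
      rw [sub_mul, hx, div_mul_cancel₀ _ hpos.ne', axis]
      ring
    rw [hsub, abs_neg, abs_mul, abs_of_pos hpos, div_eq_inv_mul _ (2 : ℝ), ← one_div]
    exact mul_le_mul_of_nonneg_right (abs_sub_round x) hpos.le
  have hle : 2 * Real.pi / k / 2 ≤ Real.pi := by
    rw [div_div, div_le_iff₀ (by positivity)]
    have : (1 : ℝ) ≤ k := Nat.one_le_cast.2 (Nat.one_le_iff_ne_zero.2 hk)
    nlinarith [Real.pi_pos]
  refine ⟨round x, ?_⟩
  change ‖v‖ * _ ≤ inner ℝ _ v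
  conv_rhs => rw [hφ, inner_smul_right, inner_unit, ← Real.cos_abs]
  exact mul_le_mul_of_nonneg_left
    (Real.cos_le_cos_of_nonneg_of_le_pi (abs_nonneg _) hle hangle) (norm_nonneg v)

/-- The corner `X` of the triangle `XYZ` spans a cone of angle `γ` with bisector in direction `φ`,
and the adjacent sides have length `1`. -/
structure IsConeCorner (φ γ : ℝ) (X Y Z : Plane) : Prop where
  angle_pos : 0 < γ
  angle_lt_pi : γ < Real.pi
  left : Y - X = unit (φ + γ / 2)
  right : Z - X = unit (φ - γ / 2)

/-- `p` is a point of `S` in the cone of angle `γ` and bisector `φ` at `q` whose projection to the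
bisector is nearest to `q`. -/
def IsConeClosest (φ γ : ℝ) (S : Finset Plane) (q p : Plane) : Prop :=
  p ∈ S ∧ p ≠ q ∧ p - q ∈ cone φ γ ∧ ∀ p' ∈ S, p' ≠ q → p' - q ∈ cone φ γ →
    inner ℝ (unit φ) (p - q) ≤ inner ℝ (unit φ) (p' - q)

/-- `p` is the most clockwise of the points that are closest to `q` in its cone. -/
def IsConeNearest (φ γ : ℝ) (S : Finset Plane) (q p : Plane) : Prop :=
  IsConeClosest φ γ S q p ∧ ∀ p', IsConeClosest φ γ S q p' → cross (p' - q) (p - q) ≤ 0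

theorem isConeClosest_congr {φ ψ : ℝ} (h : unit φ = unit ψ) {γ : ℝ} {S : Finset Plane}
    {q p : Plane} : IsConeClosest φ γ S q p ↔ IsConeClosest ψ γ S q p := by
  rw [IsConeClosest, IsConeClosest, cone_congr h, h]

theorem isConeNearest_congr {φ ψ : ℝ} (h : unit φ = unit ψ) {γ : ℝ} {S : Finset Plane}
    {q p : Plane} : IsConeNearest φ γ S q p ↔ IsConeNearest ψ γ S q p := by
  simp only [IsConeNearest, isConeClosest_congr h]

namespace IsConeCorner

variable {φ γ : ℝ} {X Y Z : Plane}

theorem cross_neg (h : IsConeCorner φ γ X Y Z) :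
    cross (Y - X) (Z - X) < 0 := by
  rw [h.left, h.right, cross_unit]
  exact Real.sin_neg_of_neg_of_neg_pi_lt (by linarith [h.angle_pos])
    (by linarith [h.angle_lt_pi])

theorem cross_side (h : IsConeCorner φ γ X Y Z) (v : Plane) :
    cross (Y - Z) v = -(2 * Real.sin (γ / 2)) * inner ℝ (unit φ) v := by
  rw [← sub_sub_sub_cancel_right Y Z X, h.left, h.right, cross_sub_left, cross_unit_add,
    cross_unit_sub]
  ring

theorem mem_wedge_iff (h : IsConeCorner φ γ X Y Z) {q p : Plane} :
    p ∈ wedge X Y Z q ↔ p - q ∈ cone φ γ := by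
  rw [mem_wedge_iff_cross (h.cross_neg), mem_cone_iff h.angle_pos h.angle_lt_pi, h.right,
    ← neg_sub Y X, h.left, cross_neg_left, neg_nonneg]

theorem two_mul_sin_pos (h : IsConeCorner φ γ X Y Z) : 0 < 2 * Real.sin (γ / 2) :=
  mul_pos two_pos (Real.sin_pos_of_pos_of_lt_pi (half_pos h.angle_pos)
    (by linarith [h.angle_pos, h.angle_lt_pi]))

theorem isFirstHit_iff (h : IsConeCorner φ γ X Y Z)
    {S : Finset Plane} {q p : Plane} : IsFirstHit X Y Z S q p ↔ IsConeClosest φ γ S q p := by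
  have htime (x : Plane) :
      sweepTime Y Z q x = 2 * Real.sin (γ / 2) * inner ℝ (unit φ) (x - q) := by
    rw [sweepTime, ← neg_sub Y Z, cross_neg_left, h.cross_side, neg_mul, neg_neg]
  simp only [IsFirstHit, IsConeClosest, h.mem_wedge_iff, htime,
    mul_le_mul_iff_right₀ h.two_mul_sin_pos]

theorem isNearest_iff (h : IsConeCorner φ γ X Y Z)
    {S : Finset Plane} {q p : Plane} : IsNearest X Y Z S q p ↔ IsConeNearest φ γ S q p := by
  simp only [IsNearest, IsConeNearest, h.isFirstHit_iff]

theorem rotate (h : IsConeCorner φ (Real.pi / 3) X Y Z) :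
    IsConeCorner (φ - 2 * (Real.pi / 3)) (Real.pi / 3) Y Z X where
  angle_pos := h.angle_pos
  angle_lt_pi := h.angle_lt_pi
  left := by
    rw [← sub_sub_sub_cancel_right Z Y X, h.left, h.right, sub_eq_iff_eq_add,
      ← unit_sub_add_unit_add (φ - _)]
    ring_nf
  right := by
    rw [← neg_sub Y X, h.left, ← unit_sub_pi]
    ring_nf

theorem neg (h : IsConeCorner φ γ X Y Z) : IsConeCorner (φ + Real.pi) γ (-X) (-Y) (-Z) where
  angle_pos := h.angle_pos
  angle_lt_pi := h.angle_lt_pi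
  left := by rw [add_right_comm, unit_add_pi, ← h.left, neg_sub_neg, neg_sub]
  right := by rw [add_sub_right_comm, unit_add_pi, ← h.right, neg_sub_neg, neg_sub]

theorem reflect_firstHit_iff (h : IsConeCorner φ γ X Y Z) {S : Finset Plane} {q p : Plane} :
    (planeCoords X Y Z h.cross_neg).reflect.FirstHit S q p ↔
      IsConeClosest (φ + Real.pi) γ S q p := by
  rw [← h.neg.isFirstHit_iff, SweepRouting.isFirstHit_iff h.neg.cross_neg]
  simp only [TriCoords.FirstHit, TriCoords.InWedge, TriCoords.reflect_a, TriCoords.reflect_b,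
    TriCoords.reflect_c, planeCoords_a, planeCoords_b, planeCoords_c, ← cross_neg_left,
    neg_sub, neg_sub_neg]

theorem sub_mem_cone_of_sideEdge (h : IsConeCorner φ γ X Y Z) {u w : Plane}
    (huw : (planeCoords X Y Z h.cross_neg).SideEdge u w) :
    w - u ∈ cone (φ + (Real.pi / 4 - γ / 4)) (Real.pi / 2 + γ / 2) := by
  obtain ⟨hb, ha⟩ := huw
  have hsin := h.two_mul_sin_pos
  rw [planeCoords_b, planeCoords_b, ← sub_nonneg, ← cross_sub_right, h.right] at hb
  rw [planeCoords_a, planeCoords_a, ← sub_nonpos, ← cross_sub_right, h.cross_side, neg_mul,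
    neg_nonpos, mul_nonneg_iff_of_pos_left hsin] at ha
  rw [mem_cone_iff (by linarith [h.angle_pos, Real.pi_pos]) (by linarith [h.angle_lt_pi])]
  constructor
  · convert hb using 3
    ring
  · rw [show φ + (Real.pi / 4 - γ / 4) + (Real.pi / 2 + γ / 2) / 2 = φ + Real.pi / 2 by ring,
      cross_unit_add, Real.cos_pi_div_two, Real.sin_pi_div_two]
    linarith

theorem sub_mem_cone_of_mirror_sideEdge (h : IsConeCorner φ γ X Y Z) {u w : Plane}
    (huw : (planeCoords X Y Z h.cross_neg).mirror.SideEdge u w) :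
    w - u ∈ cone (φ - (Real.pi / 4 - γ / 4)) (Real.pi / 2 + γ / 2) := by
  obtain ⟨hc, ha⟩ := huw
  have hsin := h.two_mul_sin_pos
  simp only [TriCoords.mirror_a, TriCoords.mirror_b, planeCoords_a, planeCoords_c] at hc ha
  rw [← sub_nonneg, ← cross_sub_right, ← neg_sub Y X, cross_neg_left, h.left, neg_nonneg] at hc
  rw [← sub_nonpos, ← cross_sub_right, h.cross_side, neg_mul, neg_nonpos,
    mul_nonneg_iff_of_pos_left hsin] at ha
  rw [mem_cone_iff (by linarith [h.angle_pos, Real.pi_pos]) (by linarith [h.angle_lt_pi])]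
  constructor
  · rw [show φ - (Real.pi / 4 - γ / 4) - (Real.pi / 2 + γ / 2) / 2 = φ - Real.pi / 2 by ring,
      cross_unit_sub, Real.cos_pi_div_two, Real.sin_pi_div_two]
    linarith
  · convert hc using 3
    ring

end IsConeCorner

theorem layer_le_layeredSweep {k : ℕ} (i : Fin k) (S : Finset Plane) :
    layer k i S ≤ layeredSweep k S :=
  le_iSup (fun i => layer k i S) i

section Layer

variable {k : ℕ} (hk : 3 ≤ k) (i : Fin k)
include hk

theorem isConeCorner_layer :
    IsConeCorner (axis k (-i)) (2 * Real.pi / k) cornerA (cornerB k i) (cornerC k i) := by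
  have hk' : (3 : ℝ) ≤ k := Nat.ofNat_le_cast.2 hk
  refine ⟨by positivity, ?_, ?_, ?_⟩
  · rw [div_lt_iff₀ (by positivity)]
    nlinarith [Real.pi_pos]
  · rw [cornerA, cornerB, sub_zero, axis]
    push_cast
    ring_nf
  · rw [cornerA, cornerC, sub_zero, axis]
    push_cast
    ring_nf

/-- The coordinates of the triangle of the `i`-th layer. -/
noncomputable def layerCoords : TriCoords Plane :=
  planeCoords cornerA (cornerB k i) (cornerC k i) (isConeCorner_layer hk i).cross_neg

theorem mem_wedgeA_iff {q p : Plane} : p ∈ wedgeA k i q ↔ (layerCoords hk i).InWedge q p :=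
  mem_wedge_iff _

theorem mem_wedgeB_iff {q p : Plane} : p ∈ wedgeB k i q ↔ (layerCoords hk i).rotate.InWedge q p :=
  mem_wedge_iff (cross_rotate cornerA _ _ ▸ (isConeCorner_layer hk i).cross_neg)

theorem mem_wedgeC_iff {q p : Plane} :
    p ∈ wedgeC k i q ↔ (layerCoords hk i).rotate.rotate.InWedge q p :=
  mem_wedge_iff (cross_rotate (cornerB k i) _ _ ▸ cross_rotate cornerA _ _ ▸
    (isConeCorner_layer hk i).cross_neg)

theorem layer_adj_iff {S : Finset Plane} {u v : Plane} :
    (layer k i S).Adj u v ↔ (layerCoords hk i).SweepAdj S u v :=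
  threeSweep_adj_iff _

theorem leftCandidate_iff {S : Finset Plane} {t u v : Plane} :
    LeftCandidate k i S t u v ↔ (layerCoords hk i).Candidate S t u v := by
  rw [LeftCandidate, layer_adj_iff hk, mem_wedgeB_iff hk, mem_wedgeB_iff hk]
  rfl

theorem rightCandidate_iff {S : Finset Plane} {t u v : Plane} :
    RightCandidate k i S t u v ↔ (layerCoords hk i).mirror.Candidate S t u v := by
  rw [RightCandidate, layer_adj_iff hk, mem_wedgeC_iff hk, mem_wedgeC_iff hk]
  exact and_congr TriCoords.sweepAdj_mirror.symm
    (and_congr TriCoords.inWedge_mirror.symm TriCoords.inWedge_mirror.symm)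

theorem turn_layerCoords_pos_iff {u w v : Plane} :
    0 < (layerCoords hk i).turn u w v ↔ cross (w - u) (v - u) < 0 := by
  rw [layerCoords, turn_planeCoords, ← neg_mul_neg,
    mul_pos_iff_of_pos_left (neg_pos.2 (isConeCorner_layer hk i).cross_neg), neg_pos]

theorem turn_mirror_layerCoords_pos_iff {u w v : Plane} :
    0 < (layerCoords hk i).mirror.turn u w v ↔ 0 < cross (w - u) (v - u) := by
  rw [TriCoords.turn_mirror, ← TriCoords.turn_comm, turn_layerCoords_pos_iff, cross_swap,
    neg_lt_zero]

theorem stepA_iff {S : Finset Plane} {t u w : Plane} :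
    StepA k i S t u w ↔ (layerCoords hk i).Step S t u w := by
  have hA (v : Plane) : IsNearest cornerA (cornerB k i) (cornerC k i) S u v ↔
      (layerCoords hk i).Nearest S u v := isNearest_iff _
  have hI : t ∈ interior (wedgeA k i u) ↔ (layerCoords hk i).InInterior u t :=
    mem_interior_wedge_iff _
  simp only [StepA, LeftStep, RightStep, TriCoords.Step, TriCoords.SideStep, hA, hI,
    mem_wedgeB_iff hk, leftCandidate_iff hk, rightCandidate_iff hk, TriCoords.nearest_mirror,
    turn_layerCoords_pos_iff, turn_mirror_layerCoords_pos_iff]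

theorem exists_mem_wedgeA (q t : Plane) : ∃ i : Fin k, t ∈ wedgeA k i q := by
  have hk0 : k ≠ 0 := by omega
  obtain ⟨n, hn⟩ := exists_mem_cone_axis hk0 (t - q)
  obtain ⟨i, hi⟩ := exists_fin_modEq hk0 (-n)
  refine ⟨i, (isConeCorner_layer hk i).mem_wedge_iff.2 ?_⟩
  rwa [cone_congr (unit_axis_congr hk0 (neg_neg n ▸ hi.neg))]

theorem carriesSweep_layeredSweep (S : Finset Plane) :
    (layerCoords hk i).CarriesSweep S (layeredSweep k S) where
  adj h := layer_le_layeredSweep i S ((layer_adj_iff hk i).2 h)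
  mem_right h := by
    obtain ⟨j, hj⟩ := SimpleGraph.iSup_adj.1 h
    exact ((layer_adj_iff hk j).1 hj).mem_right

theorem NoTies.tieFree {S : Finset Plane} (h : NoTies k S) : (layerCoords hk i).TieFree S := by
  have hA := (isConeCorner_layer hk i).cross_neg
  have hB := cross_rotate _ _ _ ▸ hA
  have hC := cross_rotate _ _ _ ▸ hB
  intro q hq p x
  have hties := h i q hq p x
  simp only [isFirstHit_iff hA, isFirstHit_iff hB, isFirstHit_iff hC] at hties
  exact hties

end Layer

section SixCones

variable {S : Finset Plane}

theorem axis_six_sub_two (n : ℤ) : axis 6 (n - 2) = axis 6 n - 2 * (Real.pi / 3) := by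
  rw [axis, axis]
  push_cast
  ring

theorem axis_six_add_three (n : ℤ) : axis 6 (n + 3) = axis 6 n + Real.pi := by
  rw [axis, axis]
  push_cast
  ring

theorem isConeNearest_axis_six_congr {m n : ℤ} (h : m ≡ n [ZMOD 6]) {q p : Plane} :
    IsConeNearest (axis 6 m) (Real.pi / 3) S q p ↔ IsConeNearest (axis 6 n) (Real.pi / 3) S q p :=
  isConeNearest_congr (unit_axis_congr (by norm_num) (by exact_mod_cast h))

/-- `q` is a point of `S` that selects `p` as its neighbour in one of the six cones of the full
`Θ₆`-graph. -/
def SelectsInSixCones (S : Finset Plane) (q p : Plane) : Prop :=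
  q ∈ S ∧ ∃ n : ℤ, IsConeNearest (axis 6 n) (Real.pi / 3) S q p

theorem fullTheta_six_adj_iff {u v : Plane} : (fullTheta 6 S).Adj u v ↔
    u ≠ v ∧ (SelectsInSixCones S u v ∨ SelectsInSixCones S v u) := by
  have htheta (j : Fin 6) (q p : Plane) :
      IsThetaNearest 6 j S q p ↔ IsConeNearest (axis 6 (j : ℕ)) (Real.pi / 3) S q p := by
    have haxis : thetaAxis 6 j = axis 6 (j : ℕ) := by
      rw [thetaAxis, axis]
      push_cast
      ring
    have hangle : 2 * Real.pi / ((6 : ℕ) : ℝ) = Real.pi / 3 := by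
      push_cast
      ring
    rw [← haxis, ← hangle]
    rfl
  have hselects (q p : Plane) :
      SelectsInSixCones S q p ↔ ∃ j : Fin 6, q ∈ S ∧ IsThetaNearest 6 j S q p := by
    simp only [htheta, SelectsInSixCones, exists_and_left]
    refine and_congr_right fun _ => ⟨fun ⟨n, hn⟩ => ?_, fun ⟨j, hj⟩ => ⟨_, hj⟩⟩
    obtain ⟨j, hj⟩ := exists_fin_modEq (k := 6) (by norm_num) n
    exact ⟨j, (isConeNearest_axis_six_congr hj).2 hn⟩
  rw [hselects, hselects, ← exists_or]
  rfl

theorem isConeCorner_layer_six (i : Fin 6) :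
    IsConeCorner (axis 6 (-i)) (Real.pi / 3) cornerA (cornerB 6 i) (cornerC 6 i) ∧
    IsConeCorner (axis 6 (-i - 2)) (Real.pi / 3) (cornerB 6 i) (cornerC 6 i) cornerA ∧
    IsConeCorner (axis 6 (-i - 2 - 2)) (Real.pi / 3) (cornerC 6 i) cornerA (cornerB 6 i) := by
  have hA : IsConeCorner (axis 6 (-i)) (Real.pi / 3) cornerA (cornerB 6 i) (cornerC 6 i) := by
    convert isConeCorner_layer (k := 6) (by norm_num) i using 1
    push_cast
    ring
  simp only [axis_six_sub_two]
  exact ⟨hA, hA.rotate, hA.rotate.rotate⟩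

theorem sweepsTo_six_iff (i : Fin 6) {q p : Plane} :
    SweepsTo cornerA (cornerB 6 i) (cornerC 6 i) S q p ↔
      q ∈ S ∧ (IsConeNearest (axis 6 (-i)) (Real.pi / 3) S q p ∨
        IsConeNearest (axis 6 (-i - 2)) (Real.pi / 3) S q p ∨
        IsConeNearest (axis 6 (-i - 2 - 2)) (Real.pi / 3) S q p) := by
  obtain ⟨hA, hB, hC⟩ := isConeCorner_layer_six i
  rw [SweepsTo, hA.isNearest_iff, hB.isNearest_iff, hC.isNearest_iff]

theorem layeredSweep_six_adj_iff {u v : Plane} : (layeredSweep 6 S).Adj u v ↔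
    u ≠ v ∧ (SelectsInSixCones S u v ∨ SelectsInSixCones S v u) := by
  have hselects (q p : Plane) : SelectsInSixCones S q p ↔
      ∃ i : Fin 6, SweepsTo cornerA (cornerB 6 i) (cornerC 6 i) S q p := by
    simp only [sweepsTo_six_iff, SelectsInSixCones, exists_and_left]
    refine and_congr_right fun _ => ⟨fun ⟨n, hn⟩ => ?_, fun ⟨i, hi⟩ => ?_⟩
    · obtain ⟨i, hi⟩ := exists_fin_modEq (k := 6) (by norm_num) (-n)
      exact ⟨i, .inl ((isConeNearest_axis_six_congr (neg_neg n ▸ hi.neg)).2 hn)⟩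
    · rcases hi with hA | hB | hC
      exacts [⟨_, hA⟩, ⟨_, hB⟩, ⟨_, hC⟩]
  rw [hselects, hselects, ← exists_or, ← exists_and_left]
  exact SimpleGraph.iSup_adj

theorem layeredSweep_six_eq_fullTheta (S : Finset Plane) : layeredSweep 6 S = fullTheta 6 S := by
  ext u v
  rw [layeredSweep_six_adj_iff, fullTheta_six_adj_iff]

theorem reflect_hitsFirst_layerCoords_six_iff (i : Fin 6) {q p : Plane} :
    (layerCoords (k := 6) (by norm_num) i).reflect.HitsFirst S q p ↔
      IsConeClosest (axis 6 (-i + 3)) (Real.pi / 3) S q p ∨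
      IsConeClosest (axis 6 (-i - 2 + 3)) (Real.pi / 3) S q p ∨
      IsConeClosest (axis 6 (-i - 2 - 2 + 3)) (Real.pi / 3) S q p := by
  obtain ⟨hA, hB, hC⟩ := isConeCorner_layer_six i
  rw [axis_six_add_three, axis_six_add_three, axis_six_add_three, ← hA.reflect_firstHit_iff,
    ← hB.reflect_firstHit_iff, ← hC.reflect_firstHit_iff]
  rfl

theorem SelectsInSixCones.sweepsTo_or_hitsFirst (i : Fin 6) {q p : Plane}
    (h : SelectsInSixCones S q p) :
    SweepsTo cornerA (cornerB 6 i) (cornerC 6 i) S q p ∨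
      (layerCoords (k := 6) (by norm_num) i).reflect.HitsFirst S q p := by
  obtain ⟨hq, n, hn⟩ := h
  have hmod : (n ≡ -i [ZMOD 6] ∨ n ≡ -i - 2 [ZMOD 6] ∨ n ≡ -i - 2 - 2 [ZMOD 6]) ∨
      n ≡ -i + 3 [ZMOD 6] ∨ n ≡ -i - 2 + 3 [ZMOD 6] ∨ n ≡ -i - 2 - 2 + 3 [ZMOD 6] := by
    simp only [Int.ModEq]
    omega
  have hcongr {m : ℤ} (hm : n ≡ m [ZMOD 6]) : IsConeNearest (axis 6 m) (Real.pi / 3) S q p :=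
    (isConeNearest_axis_six_congr hm).1 hn
  rw [sweepsTo_six_iff, reflect_hitsFirst_layerCoords_six_iff]
  exact hmod.imp (fun hsame => ⟨hq, hsame.imp hcongr (Or.imp hcongr hcongr)⟩)
    (Or.imp (hcongr · |>.1) (Or.imp (hcongr · |>.1) (hcongr · |>.1)))

theorem carriesTieFreeSweep_layeredSweep_six (hS : NoTies 6 S) (i : Fin 6) :
    (layerCoords (k := 6) (by norm_num) i).CarriesTieFreeSweep S (layeredSweep 6 S) where
  toCarriesSweep := carriesSweep_layeredSweep _ i S
  tieFree := hS.tieFree _ i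
  cases {u v} h := by
    have hadj (h' : SweepsTo cornerA (cornerB 6 i) (cornerC 6 i) S u v ∨
        SweepsTo cornerA (cornerB 6 i) (cornerC 6 i) S v u) :
        (layerCoords (k := 6) (by norm_num) i).SweepAdj S u v :=
      (layer_adj_iff _ i).1 ⟨h.ne, h'⟩
    rcases (layeredSweep_six_adj_iff.1 h).2 with huv | hvu
    · exact (huv.sweepsTo_or_hitsFirst i).imp (hadj ∘ .inl) .inl
    · exact (hvu.sweepsTo_or_hitsFirst i).imp (hadj ∘ .inr) .inr

end SixCones

theorem Router.route_eq_iterate {k : ℕ} (R : Router k) (r : ℕ) (G : SimpleGraph Plane)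
    (i : Fin k) (q t : Plane) (n : ℕ) :
    R.route r G i q t n = (fun u => R.next i t u (localView G r u))^[n] q := by
  induction n with
  | zero => rfl
  | succ n ih => rw [Function.iterate_succ_apply', ← ih, Router.route]

theorem localView_adj_iff {G : SimpleGraph Plane} {r : ℕ} (hr : 0 < r) {u v : Plane} :
    (localView G r u).Adj u v ↔ G.Adj u v :=
  ⟨fun h => h.1, fun h => ⟨h, .inl ⟨.nil, hr⟩⟩⟩

theorem localView_adj_iff_of_adj {G : SimpleGraph Plane} {r : ℕ} (hr : 1 < r) {u v x : Plane}
    (h : G.Adj u v) : (localView G r u).Adj v x ↔ G.Adj v x :=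
  ⟨fun h' => h'.1, fun h' => ⟨h', .inl ⟨h.toWalk, hr⟩⟩⟩

section LocalRouter

variable {k : ℕ} (hk : 3 ≤ k) {r : ℕ} {P : Finset Plane → Prop}

/-- On the point sets with property `P`, the steps of the algorithm from the states that it can
reach depend on the point set only through its `r`-neighbourhoods. -/
def StepsAreLocal (r : ℕ) (P : Finset Plane → Prop) : Prop :=
  ∀ (i : Fin k) (t u : Plane) (S S' : Finset Plane), P S → P S' → u ≠ t →
    (layerCoords hk i).State S t u → (layerCoords hk i).State S' t u →
    localView (layeredSweep k S) r u = localView (layeredSweep k S') r u →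
    ∀ w, (layerCoords hk i).Step S t u w ↔ (layerCoords hk i).Step S' t u w

/-- The router that executes a step of the algorithm on some point set with property `P` that is
consistent with the visible `r`-neighbourhood. -/
noncomputable def localRouter (r : ℕ) (P : Finset Plane → Prop) : Router k where
  start q t := (exists_mem_wedgeA hk q t).choose
  next i t u G := Classical.epsilon fun w => ∃ S, P S ∧ (layerCoords hk i).State S t u ∧
    localView (layeredSweep k S) r u = G ∧ (layerCoords hk i).Step S t u w

variable {hk} (hlocal : StepsAreLocal hk r P) {S : Finset Plane} (hS : P S) {i : Fin k}
  {q t : Plane}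
include hlocal hS

theorem StepsAreLocal.step_next {u : Plane} (hu : (layerCoords hk i).State S t u) (hne : u ≠ t) :
    (layerCoords hk i).Step S t u
      ((localRouter hk r P).next i t u (localView (layeredSweep k S) r u)) := by
  obtain ⟨w, hw⟩ := hu.exists_step hne
  obtain ⟨S', hS', hu', hview, hstep⟩ := Classical.epsilon_spec
    (p := fun w => ∃ S', P S' ∧ (layerCoords hk i).State S' t u ∧
      localView (layeredSweep k S') r u = localView (layeredSweep k S) r u ∧
      (layerCoords hk i).Step S' t u w) ⟨w, S, hS, hu, rfl, hw⟩
  exact (hlocal i t u S' S hS' hS hne hu' hu hview _).1 hstep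

theorem StepsAreLocal.exists_route (hq : q ∈ S) (ht : t ∈ S) (hi : t ∈ wedgeA k i q) :
    ∃ m φ, (localRouter hk r P).route r (layeredSweep k S) i q t m = t ∧ ∀ j < m,
      (layerCoords hk i).State S t ((localRouter hk r P).route r (layeredSweep k S) i q t j) ∧
      (localRouter hk r P).route r (layeredSweep k S) i q t j ≠ t ∧
      (localRouter hk r P).route r (layeredSweep k S) i q t (j + 1) -
        (localRouter hk r P).route r (layeredSweep k S) i q t j ∈
          cone φ (Real.pi / 2 + Real.pi / k) := by
  have hcorner := isConeCorner_layer hk i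
  have hwidth : Real.pi / 2 + 2 * Real.pi / k / 2 = Real.pi / 2 + Real.pi / k := by ring
  simp only [Router.route_eq_iterate]
  rcases (TriCoords.State.of_inWedge hq ht ((mem_wedgeA_iff hk i).1 hi)).reaches
    (fun u hu hne => hlocal.step_next hS hu hne) with ⟨m, hm, hj⟩ | ⟨m, hm, hj⟩
  · exact ⟨m, _, hm, fun j hjm => ⟨(hj j hjm).2.1, (hj j hjm).1,
      hwidth ▸ hcorner.sub_mem_cone_of_sideEdge (hj j hjm).2.2⟩⟩
  · exact ⟨m, _, hm, fun j hjm => ⟨(hj j hjm).2.1, (hj j hjm).1,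
      hwidth ▸ hcorner.sub_mem_cone_of_mirror_sideEdge (hj j hjm).2.2⟩⟩

omit hS in
theorem StepsAreLocal.works : (localRouter hk r P).Works r P (Real.pi / 2 + Real.pi / k)
    (1 / Real.cos (Real.pi / 4 + Real.pi / k / 2)) := by
  refine ⟨fun q t => (exists_mem_wedgeA hk q t).choose_spec, fun S hS q hq t ht i hi => ?_⟩
  obtain ⟨m, φ, hm, hj⟩ := hlocal.exists_route hS hq ht hi
  have hcone := fun j hjm => (hj j hjm).2.2
  refine ⟨m, hm, fun j hjm => ?_, ⟨φ, hcone⟩, ?_⟩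
  · obtain ⟨hstate, hne, -⟩ := hj j hjm
    have hstep := hlocal.step_next hS hstate hne
    exact ⟨hne, (carriesSweep_layeredSweep hk i S).adj (hstate.sweepAdj hne hstep),
      (stepA_iff hk i).2 hstep⟩
  · have hk' : (3 : ℝ) ≤ k := Nat.ofNat_le_cast.2 hk
    have hhalf : Real.pi / 4 + Real.pi / k / 2 = (Real.pi / 2 + Real.pi / k) / 2 := by ring
    have hlt : Real.pi / k < Real.pi / 2 := by gcongr; linarith
    have hcos : 0 < Real.cos ((Real.pi / 2 + Real.pi / k) / 2) :=
      Real.cos_pos_of_mem_Ioo ⟨by linarith [show 0 < Real.pi / 2 + Real.pi / k by positivity],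
        by linarith⟩
    simpa only [hhalf, hm, Router.route] using pathLength_le_of_mem_cone hcos hcone

end LocalRouter

theorem exists_router_two {k : ℕ} (hk : 3 ≤ k) :
    ∃ R : Router k, R.Works 2 (fun _ => True) (Real.pi / 2 + Real.pi / k)
      (1 / Real.cos (Real.pi / 4 + Real.pi / k / 2)) := by
  refine ⟨_, StepsAreLocal.works (hk := hk) fun i t u S S' _ _ _ hu hu' hview w => ?_⟩
  have hN (v) : (layeredSweep k S).Adj u v ↔ (layeredSweep k S').Adj u v := by
    rw [← localView_adj_iff two_pos, hview, localView_adj_iff two_pos]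
  refine (carriesSweep_layeredSweep hk i S).step_iff_of_two_neighborhood
    (carriesSweep_layeredSweep hk i S') hu.mem hu'.mem hN fun v hv x => ?_
  rw [← localView_adj_iff_of_adj one_lt_two hv, hview,
    localView_adj_iff_of_adj one_lt_two ((hN v).1 hv)]

theorem exists_router_one :
    ∃ R : Router 6, R.Works 1 (fun S => NoTies 6 S) (Real.pi / 2 + Real.pi / ((6 : ℕ) : ℝ))
      (1 / Real.cos (Real.pi / 4 + Real.pi / ((6 : ℕ) : ℝ) / 2)) := by
  have hk : 3 ≤ 6 := by norm_num
  refine ⟨_, StepsAreLocal.works (hk := hk) fun i t u S S' hS hS' hne hu hu' hview w => ?_⟩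
  refine (carriesTieFreeSweep_layeredSweep_six hS i).step_iff_of_neighborhood
    (carriesTieFreeSweep_layeredSweep_six hS' i) hu hu' hne fun v => ?_
  rw [← localView_adj_iff one_pos, hview, localView_adj_iff one_pos]

theorem width_six : Real.pi / 2 + Real.pi / ((6 : ℕ) : ℝ) = 2 * Real.pi / 3 := by
  push_cast
  ring

theorem ratio_six : 1 / Real.cos (Real.pi / 4 + Real.pi / ((6 : ℕ) : ℝ) / 2) = 2 := by
  rw [show Real.pi / 4 + Real.pi / ((6 : ℕ) : ℝ) / 2 = Real.pi / 3 by push_cast; ring,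
    Real.cos_pi_div_three]
  norm_num

end SweepRouting

theorem mainTheorem3_general :
    (∀ k : ℕ, 3 ≤ k →
      ∃ R : Router k, R.Works 2 (fun _ => True)
        (Real.pi / 2 + Real.pi / k) (1 / Real.cos (Real.pi / 4 + Real.pi / k / 2))) ∧
    (∀ S : Finset Plane, layeredSweep 6 S = fullTheta 6 S) ∧
    (∃ R : Router 6, R.Works 2 (fun _ => True) (2 * Real.pi / 3) 2) ∧
    (∃ R : Router 6, R.Works 1 (fun S => NoTies 6 S) (2 * Real.pi / 3) 2) := by
  refine ⟨fun k hk => exists_router_two hk, layeredSweep_six_eq_fullTheta, ?_, ?_⟩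
  · have h := exists_router_two (k := 6) (by norm_num)
    rwa [width_six, ratio_six] at h
  · have h := exists_router_one
    rwa [width_six, ratio_six] at h

theorem mainTheorem3 :
    (∀ k : ℕ, 5 ≤ k →
      ∃ R : Router k, R.Works 2 (fun _ => True)
        (Real.pi / 2 + Real.pi / k) (1 / Real.cos (Real.pi / 4 + Real.pi / k / 2))) ∧
    (∀ S : Finset Plane, layeredSweep 6 S = fullTheta 6 S) ∧
    (∃ R : Router 6, R.Works 2 (fun _ => True) (2 * Real.pi / 3) 2) ∧
    (∃ R : Router 6, R.Works 1 (fun S => NoTies 6 S) (2 * Real.pi / 3) 2) :=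
  ⟨fun k hk => mainTheorem3_general.1 k (by omega), mainTheorem3_general.2⟩
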